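/- Let $E=(E^0,E^1,r,s)$ be a directed graph with countable vertex set $E^0$ and countable edge set $E^1$, let $R$ be an integral domain, and let $L_R(E)$ be the Leavitt path algebra, i.e. the universal (not necessarily unital) associative $R$-algebra generated by pairwise orthogonal idempotents $v\in E^0$ and elements $e,e^*$ ($e\in E^1$) with $s(e)e=e\,r(e)=e$, $r(e)e^*=e^*s(e)=e^*$, $e^*f=\delta_{e,f}\,r(e)$ for all $e,f\in E^1$, and $v=\sum_{s(e)=v}ee^*$ whenever $0<|s^{-1}(v)|<\infty$. It is $\mathbb Z$-graded with $L_R(E)_k=\mathrm{span}_R\{\alpha\beta^*:\alpha,\beta\text{ paths},\ |\alpha|-|\beta|=k\}$. Ideals are two-sided. An ideal $I$ is *prime* if $I\neq L_R(E)$ and, for all ideals $J_1,J_2$, $J_1J_2\subseteq I$ implies $J_1\subseteq I$ or $J_2\subseteq I$; *graded* if $I=\bigoplus_k (I\cap L_R(E)_k)$; *basic* if for every $r\in R\setminus\{0\}$, $rx\in I$ implies $x\in I$ whenever $x\in E^0$ or $x=v-\sum_{i=1}^n e_ie_i^*$ with $v\in E^0$ and $e_1,\dots,e_n$ distinct edges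 with source $v$. Write $v\ge w$ if there is a path (possibly of length $0$) from $v$ to $w$. For a non-empty $X\subseteq E^0$ let $\Omega(X)=\{w\in E^0\setminus X: w\not\ge v\text{ for every }v\in X\}$, and $\Omega(v)=\Omega(\{v\})$. For a hereditary saturated set $H\subseteq E^0$ (hereditary: $s(e)\in H$ implies $r(e)\in H$; saturated: $0<|s^{-1}(v)|<\infty$ and $r(s^{-1}(v))\subseteq H$ imply $v\in H$) let $$B_H=\{v\in E^0\setminus H: |s^{-1}(v)|=\infty,\ 0<|s^{-1}(v)\cap r^{-1}(E^0\setminus H)|<\infty\},\qquad v^H=v-\sum_{s(e)=v,\ r(e)\notin H}ee^*\quad(v\in B_H),$$ and for $S\subseteq B_H$ let $I(H,S)$ be the ideal generated by $H\cup\{v^H:v\in S\}$. A *maximal tail* is a non-empty $M\subseteq E^0$ such that (1) $v\ge w\in M$ implies $v\in M$; (2) every $v\in M$ with $0<|s^{-1}(v)|<\infty$ emits an edge $e$ with $r(e)\in M$; (3) for all $v,w\in M$ there is $y\in M$ with $v\ge y$ and $w\ge y$. A *breaking vertex* is a vertex $v$ with $|s^{-1}(v)|=\infty$ and $v\in B_{\Omega(v)}$.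 **Theorem 4.8.** The set of prime graded basic ideals of $L_R(E)$ is $$\{I(\Omega(M),B_{\Omega(M)}): M\text{ a maximal tail in }E\}\ \cup\ \{I(\Omega(v),B_{\Omega(v)}\setminus\{v\}): v\text{ a breaking vertex of }E\}.$$ -/

import Mathlib

/-!
Directed graphs are quivers: the type of vertices is `E`, the set of all edges is `Quiver.Total E`
(with source `left` and range `right`), the set of edges emitted by a vertex `v` is
`Quiver.Star v`, whose elements are pairs `⟨w, e⟩` with `e : v ⟶ w`, and paths (including the paths
of length zero, one for each vertex) are `Quiver.Path`.
-/

universe u w x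

section Graph

variable {E : Type u} [Quiver.{w} E]

/-- `v ≥ w`: there is a path, possibly of length zero, from `v` to `w`. -/
def GraphGE (v w : E) : Prop := Nonempty (Quiver.Path v w)

/-- `Ω(X)`: the vertices outside `X` from which no vertex of `X` can be reached. -/
def graphOmega (X : Set E) : Set E := {w | w ∉ X ∧ ∀ v ∈ X, ¬ GraphGE w v}

/-- `B_H`: the infinite emitters outside `H` that emit at least one but only finitely many edges
to vertices outside `H`. -/
def graphB (H : Set E) : Set E :=
  {v | v ∉ H ∧ Infinite (Quiver.Star v) ∧
    {e : Quiver.Star v | e.1 ∉ H}.Nonempty ∧ {e : Quiver.Star v | e.1 ∉ H}.Finite}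

/-- Maximal tails: nonempty sets of vertices with (MT1), (MT2), (MT3). -/
structure IsMaximalTail (M : Set E) : Prop where
  nonempty : M.Nonempty
  mt1 : ∀ v w : E, w ∈ M → GraphGE v w → v ∈ M
  mt2 : ∀ v ∈ M, Nonempty (Quiver.Star v) → Finite (Quiver.Star v) →
    ∃ e : Quiver.Star v, e.1 ∈ M
  mt3 : ∀ v ∈ M, ∀ w ∈ M, ∃ y ∈ M, GraphGE v y ∧ GraphGE w y

/-- Breaking vertices: infinite emitters `v` with `v ∈ B_{Ω(v)}`, where `Ω(v) = Ω({v})`. -/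
def IsBreakingVertex (v : E) : Prop :=
  Infinite (Quiver.Star v) ∧ v ∈ graphB (graphOmega {v})

end Graph

noncomputable section

/-- The generators of the Leavitt path algebra: vertices, real edges `e` and ghost edges `e*`. -/
inductive LeavittGen (E : Type u) [Quiver.{w} E] : Type (max u w)
  | vertex (v : E) : LeavittGen E
  | edge (e : Quiver.Total E) : LeavittGen E
  | ghost (e : Quiver.Total E) : LeavittGen E

/-- The free associative `R`-algebra without unit on the generators: the semigroup algebra of the
free semigroup. -/
abbrev LeavittFree (R : Type x) [CommRing R] (E : Type u) [Quiver.{w} E] : Type (max u w x) :=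
  MonoidAlgebra R (FreeSemigroup (LeavittGen E))

/-- A generator as an element of the free algebra. -/
def LeavittFree.of (R : Type x) [CommRing R] {E : Type u} [Quiver.{w} E] (g : LeavittGen E) :
    LeavittFree R E :=
  MonoidAlgebra.single (FreeSemigroup.of g) 1

open LeavittGen LeavittFree in
/-- The defining relations of a Leavitt `E`-family, and their multiples by scalars. -/
inductive LeavittRel (R : Type x) [CommRing R] (E : Type u) [Quiver.{w} E] :
    LeavittFree R E → LeavittFree R E → Prop
  | vertex_idem (v : E) : LeavittRel R E (of R (vertex v) * of R (vertex v)) (of R (vertex v))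
  | vertex_orth (v w : E) (h : v ≠ w) : LeavittRel R E (of R (vertex v) * of R (vertex w)) 0
  | source_edge (e : Quiver.Total E) :
      LeavittRel R E (of R (vertex e.left) * of R (edge e)) (of R (edge e))
  | edge_range (e : Quiver.Total E) :
      LeavittRel R E (of R (edge e) * of R (vertex e.right)) (of R (edge e))
  | range_ghost (e : Quiver.Total E) :
      LeavittRel R E (of R (vertex e.right) * of R (ghost e)) (of R (ghost e))
  | ghost_source (e : Quiver.Total E) :
      LeavittRel R E (of R (ghost e) * of R (vertex e.left)) (of R (ghost e))
  | ghost_edge_self (e : Quiver.Total E) :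
      LeavittRel R E (of R (ghost e) * of R (edge e)) (of R (vertex e.right))
  | ghost_edge_ne (e f : Quiver.Total E) (h : e ≠ f) :
      LeavittRel R E (of R (ghost e) * of R (edge f)) 0
  | finite_emitter (v : E) [Fintype (Quiver.Star v)] [Nonempty (Quiver.Star v)] :
      LeavittRel R E (of R (vertex v))
        (∑ e : Quiver.Star v, of R (edge ⟨v, e.1, e.2⟩) * of R (ghost ⟨v, e.1, e.2⟩))
  | smul (r : R) {a b : LeavittFree R E} (h : LeavittRel R E a b) : LeavittRel R E (r • a) (r • b)

/-- The congruence on the free algebra generated by the defining relations. -/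
def leavittCon (R : Type x) [CommRing R] (E : Type u) [Quiver.{w} E] : RingCon (LeavittFree R E) :=
  ringConGen (LeavittRel R E)

theorem leavittCon_smul (R : Type x) [CommRing R] (E : Type u) [Quiver.{w} E] (r : R)
    {a b : LeavittFree R E} (h : leavittCon R E a b) : leavittCon R E (r • a) (r • b) := by
  change RingConGen.Rel _ a b at h
  change RingConGen.Rel _ (r • a) (r • b)
  induction h with
  | of a b h => exact .of _ _ (.smul r h)
  | refl a => exact .refl _
  | symm _ ih => exact .symm ih
  | trans _ _ ih₁ ih₂ => exact .trans ih₁ ih₂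
  | add _ _ ih₁ ih₂ => rw [smul_add, smul_add]; exact .add ih₁ ih₂
  | mul _ h₂ ih₁ _ => rw [← smul_mul_assoc, ← smul_mul_assoc]; exact .mul ih₁ h₂

/-- The Leavitt path algebra `L_R(E)`: the associative `R`-algebra (in general without unit)
presented by the generators and relations of a Leavitt `E`-family. -/
def LeavittPathAlgebra (R : Type x) [CommRing R] (E : Type u) [Quiver.{w} E] : Type (max u w x) :=
  (leavittCon R E).Quotient

namespace LeavittPathAlgebra

section Structure

variable (R : Type x) [CommRing R] (E : Type u) [Quiver.{w} E]

instance : NonUnitalRing (LeavittPathAlgebra R E) :=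
  inferInstanceAs (NonUnitalRing (leavittCon R E).Quotient)

/-- The class in `L_R(E)` of an element of the free algebra. -/
def mk (a : LeavittFree R E) : LeavittPathAlgebra R E := (leavittCon R E).toQuotient a

variable {R E}

theorem mk_surjective : Function.Surjective (mk R E) := Quotient.mk_surjective

theorem mk_eq_mk {a b : LeavittFree R E} : mk R E a = mk R E b ↔ leavittCon R E a b :=
  (leavittCon R E).eq

instance : SMul R (LeavittPathAlgebra R E) where
  smul r := Quotient.map (r • ·) fun _ _ h => leavittCon_smul R E r h

theorem mk_add (a b : LeavittFree R E) : mk R E (a + b) = mk R E a + mk R E b := rfl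

theorem mk_mul (a b : LeavittFree R E) : mk R E (a * b) = mk R E a * mk R E b := rfl

theorem mk_zero : mk R E 0 = 0 := rfl

theorem mk_smul (r : R) (a : LeavittFree R E) : mk R E (r • a) = r • mk R E a := rfl

instance : Module R (LeavittPathAlgebra R E) where
  one_smul a := by
    obtain ⟨a, rfl⟩ := mk_surjective a
    rw [← mk_smul, one_smul]
  mul_smul r s a := by
    obtain ⟨a, rfl⟩ := mk_surjective a
    simp only [← mk_smul, mul_smul]
  smul_zero r := by rw [← mk_zero, ← mk_smul, smul_zero]
  smul_add r a b := by
    obtain ⟨a, rfl⟩ := mk_surjective a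
    obtain ⟨b, rfl⟩ := mk_surjective b
    simp only [← mk_smul, ← mk_add, smul_add]
  add_smul r s a := by
    obtain ⟨a, rfl⟩ := mk_surjective a
    simp only [← mk_smul, ← mk_add, add_smul]
  zero_smul a := by
    obtain ⟨a, rfl⟩ := mk_surjective a
    rw [← mk_smul, zero_smul, mk_zero]

instance : IsScalarTower R (LeavittPathAlgebra R E) (LeavittPathAlgebra R E) where
  smul_assoc r a b := by
    obtain ⟨a, rfl⟩ := mk_surjective a
    obtain ⟨b, rfl⟩ := mk_surjective b
    simp only [smul_eq_mul, ← mk_smul, ← mk_mul, smul_mul_assoc]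

instance : SMulCommClass R (LeavittPathAlgebra R E) (LeavittPathAlgebra R E) where
  smul_comm r a b := by
    obtain ⟨a, rfl⟩ := mk_surjective a
    obtain ⟨b, rfl⟩ := mk_surjective b
    simp only [smul_eq_mul, ← mk_smul, ← mk_mul, mul_smul_comm]

end Structure

section Elements

variable (R : Type x) [CommRing R] {E : Type u} [Quiver.{w} E]

/-- The vertex `v` as an element of `L_R(E)`. -/
def vertex (v : E) : LeavittPathAlgebra R E := mk R E (LeavittFree.of R (.vertex v))

/-- The edge `e` as an element of `L_R(E)`. -/
def edge {a b : E} (e : a ⟶ b) : LeavittPathAlgebra R E :=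
  mk R E (LeavittFree.of R (.edge ⟨a, b, e⟩))

/-- The ghost edge `e*` as an element of `L_R(E)`. -/
def ghost {a b : E} (e : a ⟶ b) : LeavittPathAlgebra R E :=
  mk R E (LeavittFree.of R (.ghost ⟨a, b, e⟩))

/-- The path `α = e₁ ⋯ eₙ` as an element of `L_R(E)`; the path of length zero at `v` is `v`. -/
def path {a : E} : {b : E} → Quiver.Path a b → LeavittPathAlgebra R E
  | _, .nil => vertex R a
  | _, .cons p e => path p * edge R e

/-- The element `α* = eₙ* ⋯ e₁*` of `L_R(E)` for a path `α = e₁ ⋯ eₙ`; for the path of length zero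
at `v` it is `v`. -/
def ghostPath {a : E} : {b : E} → Quiver.Path a b → LeavittPathAlgebra R E
  | _, .nil => vertex R a
  | _, .cons p e => ghost R e * ghostPath p

variable (E) in
/-- The homogeneous component `L_R(E)_k`, spanned by the `α β*` with `|α| - |β| = k`. Only paths
with the same range are listed, since `α β* = 0` for all other pairs. -/
def component (k : ℤ) : Submodule R (LeavittPathAlgebra R E) :=
  Submodule.span R {z | ∃ (a b c : E) (α : Quiver.Path a c) (β : Quiver.Path b c),
    (α.length : ℤ) - (β.length : ℤ) = k ∧ z = path R α * ghostPath R β}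

/-- `v^H = v - ∑ e e*`, the sum over the edges `e` with source `v` and range outside `H`
(which are finitely many for `v ∈ B_H`). -/
def vertexGap (H : Set E) (v : E) : LeavittPathAlgebra R E :=
  vertex R v - ∑ᶠ e ∈ {e : Quiver.Star v | e.1 ∉ H}, edge R e.2 * ghost R e.2

/-- `I(H, S)`: the two-sided ideal generated by the `v ∈ H` and the `v^H` with `v ∈ S`. -/
def idealOfPair (H S : Set E) : TwoSidedIdeal (LeavittPathAlgebra R E) :=
  TwoSidedIdeal.span (vertex R '' H ∪ vertexGap R H '' S)

end Elements

section Ideals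

variable {R : Type x} [CommRing R] {E : Type u} [Quiver.{w} E]

/-- Prime ideals: proper two-sided ideals `I` such that `J K ⊆ I` implies `J ⊆ I` or `K ⊆ I`, for
all two-sided ideals `J`, `K`. (`J K ⊆ I` holds if and only if `I` contains all products `a b` with
`a ∈ J`, `b ∈ K`.) -/
def IsPrimeIdeal (I : TwoSidedIdeal (LeavittPathAlgebra R E)) : Prop :=
  I ≠ ⊤ ∧ ∀ J K : TwoSidedIdeal (LeavittPathAlgebra R E),
    (∀ a ∈ J, ∀ b ∈ K, a * b ∈ I) → J ≤ I ∨ K ≤ I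

/-- Graded ideals: every element of `I` is a finite sum of homogeneous elements that lie in `I`. -/
def IsGradedIdeal (I : TwoSidedIdeal (LeavittPathAlgebra R E)) : Prop :=
  ∀ z ∈ I, ∃ f : ℤ →₀ LeavittPathAlgebra R E,
    (∀ k, f k ∈ component R E k ∧ f k ∈ I) ∧ z = f.sum fun _ y => y

/-- Basic ideals: for `r ≠ 0`, if `r x ∈ I` then `x ∈ I`, for `x` a vertex `v` and for
`x = v - ∑ eᵢ eᵢ*` with finitely many (distinct) edges `eᵢ` with source `v`. -/
def IsBasicIdeal (I : TwoSidedIdeal (LeavittPathAlgebra R E)) : Prop :=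
  (∀ r : R, r ≠ 0 → ∀ v : E, r • vertex R v ∈ I → vertex R v ∈ I) ∧
  ∀ r : R, r ≠ 0 → ∀ (v : E) (F : Finset (Quiver.Star v)),
    r • (vertex R v - ∑ e ∈ F, edge R e.2 * ghost R e.2) ∈ I →
      vertex R v - ∑ e ∈ F, edge R e.2 * ghost R e.2 ∈ I

end Ideals

end LeavittPathAlgebra

end

/-! Everything rests on two tools that describe $I(H,S)$, for $H$ hereditary saturated and
$S\subseteq B_H$.

Reduction (`exists_reduction`): a homogeneous element outside $I(H,S)$ can be compressed, by a ghost
path on the left and a path on the right, to $ry$ modulo $I(H,S)$, with $ry\notin I(H,S)$ and $y$ a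
corner: a vertex $u\notin H$ or some $u^H$ with $u\in B_H\setminus S$.

Representation (`EdgeCoding.rep`): $L_R(E)$ acts on $R$-valued functions on $E^0\times\mathbb
N\times\mathbb Z$. A vertex outside $H$ restricts to its fibre, an edge embeds the fibre of its
range into that of its source, and the $\mathbb Z$-coordinate records degree. The images of the
edges fill a fibre whenever a relation $v=\sum ee^*$ or $v^H=0$ demands it, and omit a point at each
$v\in B_H\setminus S$. Generators of $I(H,S)$ act as zero and nonzero multiples of corners do not,
so by reduction the kernel is exactly $I(H,S)$ (`ker_eq_idealOfPair`). Hence $I(H,S)$ is graded, and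
over a domain the quotient is torsion-free, so $I(H,S)$ is basic. It is prime when any two corners
compress to a common one: ideals not contained in $I(H,S)$ then contain elements whose leading parts
are multiples of the same idempotent, and these multiply to something nonzero.

Conversely, reduction shows that a graded basic ideal $I$ is generated by the vertices and elements
$v^H$ in it (`eq_idealOfPair_vertexSet`). If $I$ is prime, the vertices outside it form a maximal
tail. If some $v^H\notin I$, primeness forces every vertex outside $I$ to reach $v$, so
$H=\Omega(v)$, and forces every other $u^H$ into $I$. Thus at most one $v^H$ is missing, which gives
the two families. -/

noncomputable section
namespace LeavittPathAlgebra

/-! ### Calculation rules for vertices, edges and paths -/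

section Relations

variable {R : Type x} [CommRing R] {E : Type u} [Quiver.{w} E]

theorem mk_eq_of_rel {a b : LeavittFree R E} (h : LeavittRel R E a b) : mk R E a = mk R E b :=
  mk_eq_mk.2 (RingConGen.Rel.of _ _ h)

theorem mk_sum {ι : Type*} (s : Finset ι) (f : ι → LeavittFree R E) :
    mk R E (∑ i ∈ s, f i) = ∑ i ∈ s, mk R E (f i) :=
  map_sum (AddMonoidHom.mk' (mk R E) mk_add) f s

@[simp] theorem vertex_mul_self (v : E) : vertex R v * vertex R v = vertex R v :=
  mk_eq_of_rel (.vertex_idem v)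

theorem vertex_mul_vertex_of_ne {v v' : E} (h : v ≠ v') : vertex R v * vertex R v' = 0 :=
  mk_eq_of_rel (.vertex_orth v v' h)

@[simp] theorem vertex_mul_edge {a b : E} (e : a ⟶ b) : vertex R a * edge R e = edge R e :=
  mk_eq_of_rel (.source_edge ⟨a, b, e⟩)

@[simp] theorem edge_mul_vertex {a b : E} (e : a ⟶ b) : edge R e * vertex R b = edge R e :=
  mk_eq_of_rel (.edge_range ⟨a, b, e⟩)

@[simp] theorem vertex_mul_ghost {a b : E} (e : a ⟶ b) : vertex R b * ghost R e = ghost R e :=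
  mk_eq_of_rel (.range_ghost ⟨a, b, e⟩)

@[simp] theorem ghost_mul_vertex {a b : E} (e : a ⟶ b) : ghost R e * vertex R a = ghost R e :=
  mk_eq_of_rel (.ghost_source ⟨a, b, e⟩)

@[simp] theorem ghost_mul_edge_self {a b : E} (e : a ⟶ b) :
    ghost R e * edge R e = vertex R b :=
  mk_eq_of_rel (.ghost_edge_self ⟨a, b, e⟩)

theorem ghost_mul_edge_of_ne {a b c d : E} {e : a ⟶ b} {f : c ⟶ d}
    (h : (⟨a, b, e⟩ : Quiver.Total E) ≠ ⟨c, d, f⟩) : ghost R e * edge R f = 0 :=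
  mk_eq_of_rel (.ghost_edge_ne _ _ h)

theorem ghost_mul_edge_of_star_ne {v : E} {e f : Quiver.Star v} (h : e ≠ f) :
    ghost R e.2 * edge R f.2 = 0 := by
  refine ghost_mul_edge_of_ne fun h' => h ?_
  obtain ⟨a, e⟩ := e
  obtain ⟨b, f⟩ := f
  cases h'
  rfl

theorem vertex_eq_sum (v : E) [Fintype (Quiver.Star v)] [Nonempty (Quiver.Star v)] :
    vertex R v = ∑ e : Quiver.Star v, edge R e.2 * ghost R e.2 :=
  (mk_eq_of_rel (.finite_emitter v)).trans (mk_sum _ _)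

@[simp] theorem vertex_mul_path {a b : E} (p : Quiver.Path a b) :
    vertex R a * path R p = path R p := by
  induction p with
  | nil => exact vertex_mul_self a
  | cons p e ih => rw [path, ← mul_assoc, ih]

@[simp] theorem path_mul_vertex {a b : E} (p : Quiver.Path a b) :
    path R p * vertex R b = path R p := by
  cases p with
  | nil => exact vertex_mul_self a
  | cons p e => rw [path, mul_assoc, edge_mul_vertex]

@[simp] theorem ghostPath_mul_vertex {a b : E} (p : Quiver.Path a b) :
    ghostPath R p * vertex R a = ghostPath R p := by
  induction p with
  | nil => exact vertex_mul_self a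
  | cons p e ih => rw [ghostPath, mul_assoc, ih]

@[simp] theorem vertex_mul_ghostPath {a b : E} (p : Quiver.Path a b) :
    vertex R b * ghostPath R p = ghostPath R p := by
  cases p with
  | nil => exact vertex_mul_self a
  | cons p e => rw [ghostPath, ← mul_assoc, vertex_mul_ghost]

theorem path_toPath {a b : E} (e : a ⟶ b) : path R e.toPath = edge R e := vertex_mul_edge e

theorem ghostPath_toPath {a b : E} (e : a ⟶ b) : ghostPath R e.toPath = ghost R e :=
  ghost_mul_vertex e

theorem path_comp {a b c : E} (p : Quiver.Path a b) (q : Quiver.Path b c) :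
    path R (p.comp q) = path R p * path R q := by
  induction q with
  | nil => exact (path_mul_vertex p).symm
  | cons q e ih => rw [Quiver.Path.comp_cons, path, ih, path, mul_assoc]

theorem ghostPath_comp {a b c : E} (p : Quiver.Path a b) (q : Quiver.Path b c) :
    ghostPath R (p.comp q) = ghostPath R q * ghostPath R p := by
  induction q with
  | nil => exact (vertex_mul_ghostPath p).symm
  | cons q e ih => rw [Quiver.Path.comp_cons, ghostPath, ih, ghostPath, mul_assoc]

@[simp] theorem ghostPath_mul_path_self {a b : E} (p : Quiver.Path a b) :
    ghostPath R p * path R p = vertex R b := by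
  induction p with
  | nil => exact vertex_mul_self a
  | cons p e ih =>
    rw [ghostPath, path, mul_assoc, ← mul_assoc (ghostPath R p), ih, vertex_mul_edge,
      ghost_mul_edge_self]

theorem vertex_mul_path_of_ne {v a b : E} (h : v ≠ a) (p : Quiver.Path a b) :
    vertex R v * path R p = 0 := by
  rw [← vertex_mul_path, ← mul_assoc, vertex_mul_vertex_of_ne h, zero_mul]

theorem ghostPath_mul_vertex_of_ne {v a b : E} (h : a ≠ v) (p : Quiver.Path a b) :
    ghostPath R p * vertex R v = 0 := by
  rw [← ghostPath_mul_vertex, mul_assoc, vertex_mul_vertex_of_ne h, mul_zero]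

/-- Distinct paths of the same length are orthogonal. -/
theorem ghostPath_mul_path_of_ne {a b a' b' : E} (p : Quiver.Path a b) (q : Quiver.Path a' b')
    (hl : p.length = q.length)
    (hne : (⟨b, a, p⟩ : Σ b a : E, Quiver.Path a b) ≠ ⟨b', a', q⟩) :
    ghostPath R p * path R q = 0 := by
  induction p generalizing b' with
  | nil =>
    cases q with
    | nil => exact vertex_mul_vertex_of_ne fun h => hne (by subst h; rfl)
    | cons q f => simp at hl
  | cons p e ih =>
    rename_i b₀ c₀
    cases q with
    | nil => simp at hl
    | cons q f =>
      rename_i d₀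
      rw [ghostPath, path, mul_assoc, ← mul_assoc (ghostPath R p)]
      by_cases h : (⟨b₀, a, p⟩ : Σ b a : E, Quiver.Path a b) = ⟨d₀, a', q⟩
      · cases h
        rw [ghostPath_mul_path_self, vertex_mul_edge, ghost_mul_edge_of_ne]
        intro h'
        cases h'
        exact hne rfl
      · rw [ih q (by simpa using hl) h, zero_mul, mul_zero]

end Relations

/-! ### Spanning by monomials, local units, homogeneous decomposition -/

section Spanning

variable {R : Type x} [CommRing R] {E : Type u} [Quiver.{w} E]

variable (R E) in
/-- The monomials `α β*` of degree `k` with `|β| ≤ n`. -/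
def monomials (k : ℤ) (n : ℕ) : Set (LeavittPathAlgebra R E) :=
  {z | ∃ (a b c : E) (α : Quiver.Path a c) (β : Quiver.Path b c),
    (α.length : ℤ) - (β.length : ℤ) = k ∧ β.length ≤ n ∧ z = path R α * ghostPath R β}

variable (R E) in
/-- The set of all monomials `α β*`. -/
def allMonomials : Set (LeavittPathAlgebra R E) :=
  {z | ∃ (a b c : E) (α : Quiver.Path a c) (β : Quiver.Path b c), z = path R α * ghostPath R β}

theorem vertex_mem_allMonomials (v : E) : vertex R v ∈ allMonomials R E :=
  ⟨v, v, v, .nil, .nil, (vertex_mul_self v).symm⟩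

theorem ghostPath_mul_edge_mem {a b c d : E} (β : Quiver.Path a b) (e : c ⟶ d)
    (hβ : β.length ≠ 0) :
    ghostPath R β * edge R e = 0 ∨ ∃ β' : Quiver.Path d b, β.length = β'.length + 1 ∧
      ghostPath R β * edge R e = ghostPath R β' := by
  obtain ⟨c', f, β', rfl, hl⟩ := (Quiver.Path.length_ne_zero_iff_eq_comp β).1 hβ
  rw [ghostPath_comp, ghostPath_toPath, mul_assoc]
  by_cases h : (⟨a, c', f⟩ : Quiver.Total E) = ⟨c, d, e⟩
  · cases h
    exact .inr ⟨β', hl, by simp⟩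
  · exact .inl (by rw [ghost_mul_edge_of_ne h, mul_zero])

/-- The rightmost factor of $\beta^*$ is the ghost of the first edge of $\beta$, so an edge on the
right either cancels it or gives zero. This lowers the ghost length in the induction of
`exists_reduction`. -/
theorem mul_edge_mem_span {k : ℤ} {n : ℕ} {a b : E} (e : a ⟶ b) {z : LeavittPathAlgebra R E}
    (hz : z ∈ Submodule.span R (monomials R E k (n + 1))) :
    z * edge R e ∈ Submodule.span R (monomials R E (k + 1) n) := by
  induction hz using Submodule.span_induction with
  | mem z hz =>
    obtain ⟨a', b', c, α, β, hk, hn, rfl⟩ := hz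
    rw [mul_assoc]
    by_cases hβ : β.length = 0
    · cases β with
      | cons β f => simp at hβ
      | nil =>
        by_cases h : b' = a
        · subst h
          refine Submodule.subset_span ⟨a', b, b, α.cons e, .nil, ?_, by simp, ?_⟩
          · simp at hk ⊢
            omega
          · simp [path, ghostPath, mul_assoc]
        · rw [← vertex_mul_edge e, ← mul_assoc (ghostPath R _), ghostPath,
            vertex_mul_vertex_of_ne h, zero_mul, mul_zero]
          exact zero_mem _
    · obtain h | ⟨β', hl, h⟩ := ghostPath_mul_edge_mem (R := R) β e hβ
      · rw [h, mul_zero]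
        exact zero_mem _
      · rw [h]
        exact Submodule.subset_span ⟨a', b, c, α, β', by omega, by omega, rfl⟩
  | zero => rw [zero_mul]; exact zero_mem _
  | add y z _ _ hy hz => rw [add_mul]; exact add_mem hy hz
  | smul r z _ hz => rw [smul_mul_assoc]; exact Submodule.smul_mem _ _ hz

theorem exists_mem_span_monomials {k : ℤ} {z : LeavittPathAlgebra R E}
    (hz : z ∈ component R E k) : ∃ n, z ∈ Submodule.span R (monomials R E k n) := by
  have mono : ∀ {m n}, m ≤ n → Submodule.span R (monomials R E k m) ≤
      Submodule.span R (monomials R E k n) := fun h => Submodule.span_mono <| by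
    rintro _ ⟨a, b, c, α, β, hk, hn, rfl⟩
    exact ⟨a, b, c, α, β, hk, hn.trans h, rfl⟩
  induction hz using Submodule.span_induction with
  | mem z hz =>
    obtain ⟨a, b, c, α, β, hk, rfl⟩ := hz
    exact ⟨β.length, Submodule.subset_span ⟨a, b, c, α, β, hk, le_rfl, rfl⟩⟩
  | zero => exact ⟨0, zero_mem _⟩
  | add y z _ _ hy hz =>
    obtain ⟨m, hm⟩ := hy
    obtain ⟨n, hn⟩ := hz
    exact ⟨max m n, add_mem (mono (le_max_left _ _) hm) (mono (le_max_right _ _) hn)⟩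
  | smul r z _ hz =>
    obtain ⟨n, hn⟩ := hz
    exact ⟨n, Submodule.smul_mem _ _ hn⟩

/-- Words in the free semigroup are built by adding generators on the left, so stability of the span
under left multiplication gives spanning. -/
theorem mk_of_mul_mem_span (g : LeavittGen E) {z : LeavittPathAlgebra R E}
    (hz : z ∈ Submodule.span R (allMonomials R E)) :
    mk R E (LeavittFree.of R g) * z ∈ Submodule.span R (allMonomials R E) := by
  induction hz using Submodule.span_induction with
  | mem z hz =>
    obtain ⟨a, b, c, α, β, rfl⟩ := hz
    rw [← mul_assoc]
    cases g with
    | vertex v =>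
      change vertex R v * _ * _ ∈ _
      by_cases h : v = a
      · subst h
        rw [vertex_mul_path]
        exact Submodule.subset_span ⟨_, _, _, α, β, rfl⟩
      · rw [vertex_mul_path_of_ne h, zero_mul]
        exact zero_mem _
    | edge e =>
      obtain ⟨d, a', e⟩ := e
      change edge R e * _ * _ ∈ _
      by_cases h : a' = a
      · subst h
        refine Submodule.subset_span ⟨_, _, _, e.toPath.comp α, β, ?_⟩
        rw [path_comp, path_toPath]
      · rw [← edge_mul_vertex, mul_assoc (edge R e), vertex_mul_path_of_ne h, mul_zero, zero_mul]
        exact zero_mem _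
    | ghost e =>
      obtain ⟨d, a', e⟩ := e
      change ghost R e * _ * _ ∈ _
      by_cases hα : α.length = 0
      · cases α with
        | cons => simp at hα
        | nil =>
          by_cases h : d = a
          · subst h
            refine Submodule.subset_span ⟨_, _, _, .nil, β.cons e, ?_⟩
            simp [path, ghostPath, ← mul_assoc]
          · rw [← ghost_mul_vertex, mul_assoc (ghost R e), vertex_mul_path_of_ne h, mul_zero,
              zero_mul]
            exact zero_mem _
      · obtain ⟨c', f, α', rfl, -⟩ := (Quiver.Path.length_ne_zero_iff_eq_comp α).1 hα
        rw [path_comp, path_toPath, ← mul_assoc]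
        by_cases h : (⟨d, a', e⟩ : Quiver.Total E) = ⟨a, c', f⟩
        · cases h
          refine Submodule.subset_span ⟨_, _, _, α', β, ?_⟩
          simp
        · rw [ghost_mul_edge_of_ne h, zero_mul, zero_mul]
          exact zero_mem _
  | zero => rw [mul_zero]; exact zero_mem _
  | add y z _ _ hy hz => rw [mul_add]; exact add_mem hy hz
  | smul r z _ hz => rw [mul_smul_comm]; exact Submodule.smul_mem _ _ hz

theorem mk_of_mem_span (g : LeavittGen E) :
    mk R E (LeavittFree.of R g) ∈ Submodule.span R (allMonomials R E) := by
  have aux (z : LeavittPathAlgebra R E) (v : E) (h : z * vertex R v = z)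
      (h' : z * vertex R v ∈ Submodule.span R (allMonomials R E)) :
      z ∈ Submodule.span R (allMonomials R E) := h ▸ h'
  cases g with
  | vertex v => exact Submodule.subset_span (vertex_mem_allMonomials v)
  | edge e =>
    exact aux _ e.right (edge_mul_vertex e.hom)
      (mk_of_mul_mem_span _ (Submodule.subset_span (vertex_mem_allMonomials _)))
  | ghost e =>
    exact aux _ e.left (ghost_mul_vertex e.hom)
      (mk_of_mul_mem_span _ (Submodule.subset_span (vertex_mem_allMonomials _)))

/-- The monomials `α β*` span the Leavitt path algebra. -/
theorem mem_span_allMonomials (z : LeavittPathAlgebra R E) :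
    z ∈ Submodule.span R (allMonomials R E) := by
  obtain ⟨z, rfl⟩ := mk_surjective z
  induction z using MonoidAlgebra.induction_linear with
  | zero => exact zero_mem _
  | add y z hy hz => exact add_mem hy hz
  | single g r =>
    have hr : (MonoidAlgebra.single g r : LeavittFree R E) = r • MonoidAlgebra.single g 1 := by
      simp
    rw [hr, mk_smul]
    refine Submodule.smul_mem _ _ ?_
    clear hr
    refine FreeSemigroup.recOnMul (C := fun g =>
      mk R E (MonoidAlgebra.single g 1) ∈ Submodule.span R (allMonomials R E)) g
      mk_of_mem_span fun g h _ ih => ?_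
    have hm : (MonoidAlgebra.single (FreeSemigroup.of g * h) 1 : LeavittFree R E) =
        LeavittFree.of R g * MonoidAlgebra.single h 1 := by
      simp [LeavittFree.of, MonoidAlgebra.single_mul_single]
    rw [hm, mk_mul]
    exact mk_of_mul_mem_span g ih

@[elab_as_elim]
theorem monomial_induction {p : LeavittPathAlgebra R E → Prop} (z : LeavittPathAlgebra R E)
    (mem : ∀ (a b c : E) (α : Quiver.Path a c) (β : Quiver.Path b c),
      p (path R α * ghostPath R β))
    (zero : p 0) (add : ∀ y z, p y → p z → p (y + z)) (smul : ∀ (r : R) z, p z → p (r • z)) :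
    p z := by
  induction mem_span_allMonomials z using Submodule.span_induction with
  | mem z hz =>
    obtain ⟨a, b, c, α, β, rfl⟩ := hz
    exact mem a b c α β
  | zero => exact zero
  | add y z _ _ hy hz => exact add y z hy hz
  | smul r z _ hz => exact smul r z hz

open Classical in
/-- Finite sums of vertices are local units. -/
theorem exists_mul_sum_vertex (z : LeavittPathAlgebra R E) :
    ∃ V : Finset E, z * ∑ v ∈ V, vertex R v = z := by
  -- Allowing all larger sets makes the claim additive: for a sum, take the union.
  suffices ∃ V : Finset E, ∀ W, V ⊆ W → z * ∑ v ∈ W, vertex R v = z by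
    obtain ⟨V, hV⟩ := this
    exact ⟨V, hV V subset_rfl⟩
  induction z using monomial_induction with
  | mem a b c α β =>
    refine ⟨{b}, fun W hW => ?_⟩
    rw [mul_assoc, Finset.mul_sum, Finset.sum_eq_single_of_mem b (by simpa using hW)]
    · rw [ghostPath_mul_vertex]
    · exact fun v _ hv => ghostPath_mul_vertex_of_ne hv.symm β
  | zero => exact ⟨∅, fun W _ => zero_mul _⟩
  | add y z hy hz =>
    obtain ⟨V, hV⟩ := hy
    obtain ⟨V', hV'⟩ := hz
    refine ⟨V ∪ V', fun W hW => ?_⟩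
    rw [add_mul, hV W (Finset.union_subset_left hW), hV' W (Finset.union_subset_right hW)]
  | smul r z hz =>
    obtain ⟨V, hV⟩ := hz
    exact ⟨V, fun W hW => by rw [smul_mul_assoc, hV W hW]⟩

/-- Ring ideals of a non-unital algebra need not be closed under scalars; here a local unit absorbs
the scalar. -/
theorem smul_mem_ideal (I : TwoSidedIdeal (LeavittPathAlgebra R E)) (r : R)
    {z : LeavittPathAlgebra R E} (hz : z ∈ I) : r • z ∈ I := by
  obtain ⟨V, hV⟩ := exists_mul_sum_vertex z
  rw [← hV, ← mul_smul_comm]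
  exact I.mul_mem_right _ _ hz

theorem exists_mul_vertex_notMem {I : TwoSidedIdeal (LeavittPathAlgebra R E)}
    {z : LeavittPathAlgebra R E} (hz : z ∉ I) : ∃ v, z * vertex R v ∉ I := by
  by_contra! h
  obtain ⟨V, hV⟩ := exists_mul_sum_vertex z
  refine hz ?_
  rw [← hV, Finset.mul_sum]
  exact sum_mem fun v _ => h v

open Classical in
/-- Every element is the sum of finitely many homogeneous elements. -/
theorem exists_finsupp_component (z : LeavittPathAlgebra R E) :
    ∃ f : ℤ →₀ LeavittPathAlgebra R E, (∀ k, f k ∈ component R E k) ∧ z = f.sum fun _ y => y := by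
  induction z using monomial_induction with
  | mem a b c α β =>
    refine ⟨Finsupp.single (α.length - β.length) (path R α * ghostPath R β), fun k => ?_, ?_⟩
    · rw [Finsupp.single_apply]
      split_ifs with h
      · exact Submodule.subset_span ⟨a, b, c, α, β, h, rfl⟩
      · exact zero_mem _
    · rw [Finsupp.sum_single_index rfl]
  | zero => exact ⟨0, fun k => zero_mem _, by simp⟩
  | add y z hy hz =>
    obtain ⟨f, hf, rfl⟩ := hy
    obtain ⟨g, hg, rfl⟩ := hz
    exact ⟨f + g, fun k => add_mem (hf k) (hg k),
      (Finsupp.sum_add_index' (fun _ => rfl) fun _ _ _ => rfl).symm⟩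
  | smul r z hz =>
    obtain ⟨f, hf, rfl⟩ := hz
    refine ⟨r • f, fun k => Submodule.smul_mem _ _ (hf k), ?_⟩
    rw [Finsupp.sum_smul_index' fun _ => rfl, Finsupp.smul_sum]

end Spanning

/-! ### The idempotents $v-\sum_{e\in F}ee^*$ -/

section Gap

variable (R : Type x) [CommRing R] {E : Type u} [Quiver.{w} E]

/-- `v - ∑ e e*`, the sum over a finite set of edges with source `v`. -/
def gap (v : E) (F : Finset (Quiver.Star v)) : LeavittPathAlgebra R E :=
  vertex R v - ∑ e ∈ F, edge R e.2 * ghost R e.2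

variable {R}

theorem vertexGap_eq_gap {H : Set E} {v : E} {F : Finset (Quiver.Star v)}
    (hF : {e : Quiver.Star v | e.1 ∉ H} = F) : vertexGap R H v = gap R v F := by
  rw [vertexGap, gap, hF]
  congr 1
  exact finsum_mem_coe_finset _ F

theorem exists_vertexGap_eq_gap {H : Set E} {v : E} (hv : v ∈ graphB H) :
    ∃ F : Finset (Quiver.Star v), {e : Quiver.Star v | e.1 ∉ H} = F ∧
      vertexGap R H v = gap R v F := by
  obtain ⟨F, hF⟩ := hv.2.2.2.exists_finset_coe
  exact ⟨F, hF.symm, vertexGap_eq_gap hF.symm⟩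

@[simp] theorem vertex_mul_gap (v : E) (F : Finset (Quiver.Star v)) :
    vertex R v * gap R v F = gap R v F := by
  simp [gap, mul_sub, Finset.mul_sum, ← mul_assoc]

@[simp] theorem gap_mul_vertex (v : E) (F : Finset (Quiver.Star v)) :
    gap R v F * vertex R v = gap R v F := by
  simp [gap, sub_mul, Finset.sum_mul, mul_assoc]

@[simp] theorem gap_empty (v : E) : gap R v ∅ = vertex R v := by simp [gap]

open Classical in
theorem ghost_mul_gap {v : E} (e : Quiver.Star v) (F : Finset (Quiver.Star v)) :
    ghost R e.2 * gap R v F = if e ∈ F then 0 else ghost R e.2 := by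
  have h : ∀ f ∈ F, ghost R e.2 * (edge R f.2 * ghost R f.2) =
      if e = f then ghost R e.2 else 0 := by
    intro f _
    rw [← mul_assoc]
    split_ifs with h
    · subst h
      simp
    · rw [ghost_mul_edge_of_star_ne h, zero_mul]
  rw [gap, mul_sub, Finset.mul_sum, Finset.sum_congr rfl h, Finset.sum_ite_eq, ghost_mul_vertex]
  split_ifs <;> simp

open Classical in
theorem gap_mul_edge {v : E} (e : Quiver.Star v) (F : Finset (Quiver.Star v)) :
    gap R v F * edge R e.2 = if e ∈ F then 0 else edge R e.2 := by
  have h : ∀ f ∈ F, edge R f.2 * ghost R f.2 * edge R e.2 =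
      if e = f then edge R e.2 else 0 := by
    intro f _
    rw [mul_assoc]
    split_ifs with h
    · subst h
      simp
    · rw [ghost_mul_edge_of_star_ne (Ne.symm h), mul_zero]
  rw [gap, sub_mul, Finset.sum_mul, Finset.sum_congr rfl h, Finset.sum_ite_eq, vertex_mul_edge]
  split_ifs <;> simp

theorem gap_mul_self (v : E) (F : Finset (Quiver.Star v)) :
    gap R v F * gap R v F = gap R v F := by
  have h : (∑ e ∈ F, edge R e.2 * ghost R e.2) * gap R v F = 0 := by
    rw [Finset.sum_mul]
    refine Finset.sum_eq_zero fun e he => ?_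
    rw [mul_assoc, ghost_mul_gap, if_pos he, mul_zero]
  conv_lhs => enter [1]; rw [gap]
  rw [sub_mul, h, vertex_mul_gap, sub_zero]

/-- Two gaps agree modulo an ideal that contains the ranges of the edges by which they differ. -/
theorem gap_sub_gap_mem {I : TwoSidedIdeal (LeavittPathAlgebra R E)} {v : E}
    {F T : Finset (Quiver.Star v)} (hFT : F ⊆ T)
    (h : ∀ e ∈ T, e ∉ F → vertex R e.1 ∈ I) : gap R v F - gap R v T ∈ I := by
  classical
  have : gap R v F - gap R v T = ∑ e ∈ T \ F, edge R e.2 * ghost R e.2 := by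
    rw [gap, gap, ← Finset.sum_sdiff hFT]
    abel
  rw [this]
  refine sum_mem fun e he => ?_
  rw [Finset.mem_sdiff] at he
  rw [← edge_mul_vertex]
  exact I.mul_mem_right _ _ (I.mul_mem_left _ _ (h e he.1 he.2))

theorem gap_univ (v : E) [Fintype (Quiver.Star v)] [Nonempty (Quiver.Star v)] :
    gap R v Finset.univ = 0 := sub_eq_zero.2 (vertex_eq_sum v)

end Gap

/-! ### Compression of homogeneous elements to corners -/

section Reduction

variable {R : Type x} [CommRing R] {E : Type u} [Quiver.{w} E]

variable (R) in
/-- The elements `u` (for vertices `u ∉ H`) and `u^H` (for `u ∈ B_H ∖ S`), whose multiples by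
nonzero scalars do not lie in `I(H, S)`. -/
inductive IsCorner (H S : Set E) : LeavittPathAlgebra R E → Prop
  | vertex (u : E) (hu : u ∉ H) : IsCorner H S (vertex R u)
  | gap (u : E) (hu : u ∈ graphB H) (hS : u ∉ S) : IsCorner H S (vertexGap R H u)

variable (R) in
/-- The linear combinations of paths of length `k` with range `v`. -/
def pathSpan (v : E) (k : ℤ) : Submodule R (LeavittPathAlgebra R E) :=
  Submodule.span R ((fun p : Σ a : E, Quiver.Path a v => path R p.2) ''
    {p | (p.2.length : ℤ) = k})

-- `T` collects the first edges of the nontrivial $\beta$ starting at `v`; the gap kills their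
-- ghosts, so only monomials with trivial $\beta$ survive.
open Classical in
theorem exists_mul_gap_eq {k : ℤ} {n : ℕ} {z : LeavittPathAlgebra R E}
    (hz : z ∈ Submodule.span R (monomials R E k n)) (v : E) :
    ∃ b ∈ pathSpan R v k, ∃ T : Finset (Quiver.Star v),
      ∀ T', T ⊆ T' → z * gap R v T' = b * gap R v T' := by
  induction hz using Submodule.span_induction with
  | mem z hz =>
    obtain ⟨a, b, c, α, β, hk, -, rfl⟩ := hz
    by_cases hbv : b = v
    · subst hbv
      by_cases hβ : β.length = 0
      · cases β with
        | cons => simp at hβ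
        | nil =>
          refine ⟨path R α, Submodule.subset_span ⟨⟨a, α⟩, by simpa using hk, rfl⟩, ∅,
            fun T' _ => ?_⟩
          simp [ghostPath]
      · obtain ⟨c', f, β', rfl, hl⟩ := (Quiver.Path.length_ne_zero_iff_eq_comp β).1 hβ
        refine ⟨0, zero_mem _, {⟨c', f⟩}, fun T' hT => ?_⟩
        rw [ghostPath_comp, ghostPath_toPath, mul_assoc, mul_assoc,
          ghost_mul_gap (⟨c', f⟩ : Quiver.Star b), if_pos (by simpa using hT)]
        simp
    · refine ⟨0, zero_mem _, ∅, fun T' _ => ?_⟩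
      rw [← vertex_mul_gap, ← mul_assoc, mul_assoc (path R α), ghostPath_mul_vertex_of_ne hbv]
      simp
  | zero => exact ⟨0, zero_mem _, ∅, by simp⟩
  | add y z _ _ hy hz =>
    obtain ⟨b, hb, T, hT⟩ := hy
    obtain ⟨c, hc, U, hU⟩ := hz
    refine ⟨b + c, add_mem hb hc, T ∪ U, fun T' hT' => ?_⟩
    rw [add_mul, add_mul, hT T' (Finset.union_subset_left hT'),
      hU T' (Finset.union_subset_right hT')]
  | smul r z _ hz =>
    obtain ⟨b, hb, T, hT⟩ := hz
    exact ⟨r • b, Submodule.smul_mem _ _ hb, T, fun T' hT' => by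
      rw [smul_mul_assoc, hT T' hT', smul_mul_assoc]⟩

/-- If `b` is a combination of paths of the same length and `b y ∉ I`, then `p* b = r v` for some
path `p` and scalar `r` with `r y ∉ I`. -/
theorem exists_ghostPath_mul_eq_smul {I : TwoSidedIdeal (LeavittPathAlgebra R E)} {v : E} {k : ℤ}
    {b y : LeavittPathAlgebra R E} (hb : b ∈ pathSpan R v k)
    (h : b * y ∉ I) :
    ∃ (a : E) (p : Quiver.Path a v) (r : R), ghostPath R p * b = r • vertex R v ∧ r • y ∉ I := by
  rw [pathSpan, Finsupp.mem_span_image_iff_linearCombination] at hb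
  obtain ⟨c, hc, rfl⟩ := hb
  rw [Finsupp.mem_supported] at hc
  rw [Finsupp.linearCombination_apply, Finsupp.sum] at *
  have h' : ∃ p ∈ c.support, c p • (path R p.2 * y) ∉ I := by
    by_contra! h'
    refine h ?_
    rw [Finset.sum_mul]
    exact sum_mem fun p hp => by
      rw [smul_mul_assoc]
      exact h' p hp
  obtain ⟨p, hp, hpy⟩ := h'
  refine ⟨p.1, p.2, c p, ?_, fun h' => hpy ?_⟩
  · rw [Finset.mul_sum, Finset.sum_eq_single_of_mem p hp, mul_smul_comm, ghostPath_mul_path_self]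
    intro q hq hqp
    rw [mul_smul_comm, ghostPath_mul_path_of_ne, smul_zero]
    · have h₁ : (p.2.length : ℤ) = k := hc hp
      have h₂ : (q.2.length : ℤ) = k := hc hq
      omega
    · intro h
      apply hqp
      simp only [Sigma.mk.injEq, heq_eq_eq, true_and] at h
      exact Sigma.ext h.1.symm h.2.symm
  · rw [← mul_smul_comm]
    exact I.mul_mem_left _ _ h'

/-- A homogeneous element outside `I(H, S)` can be brought to the form `r x`, with `x` a corner,
by multiplication with paths from the right and ghost paths from the left. -/
theorem exists_reduction {H S : Set E}
    (hH : ∀ (r : R) (v : E), r ≠ 0 → r • vertex R v ∈ idealOfPair R H S → v ∈ H) {n : ℕ} {k : ℤ}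
    {z : LeavittPathAlgebra R E} (hz : z ∈ Submodule.span R (monomials R E k n))
    (hzI : z ∉ idealOfPair R H S) :
    ∃ (a b c d : E) (p : Quiver.Path a b) (q : Quiver.Path c d) (r : R)
      (y : LeavittPathAlgebra R E), IsCorner R H S y ∧ r • y ∉ idealOfPair R H S ∧
        ghostPath R p * z * path R q - r • y ∈ idealOfPair R H S := by
  classical
  set J := idealOfPair R H S with hJ
  have hHJ : ∀ v ∈ H, vertex R v ∈ J := fun v hv =>
    TwoSidedIdeal.subset_span (.inl ⟨v, hv, rfl⟩)
  induction n generalizing k z with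
  | zero =>
    obtain ⟨v, hv⟩ := exists_mul_vertex_notMem hzI
    have hb : z * vertex R v ∈ pathSpan R v k := by
      clear hv hzI
      induction hz using Submodule.span_induction with
      | mem z hz =>
        obtain ⟨a, b, c, α, β, hk, hn, rfl⟩ := hz
        cases β with
        | cons => simp at hn
        | nil =>
          by_cases h : b = v
          · subst h
            exact Submodule.subset_span ⟨⟨a, α⟩, by simpa using hk, by simp [ghostPath]⟩
          · rw [mul_assoc, ghostPath_mul_vertex_of_ne h, mul_zero]
            exact zero_mem _
      | zero => rw [zero_mul]; exact zero_mem _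
      | add y z _ _ hy hz => rw [add_mul]; exact add_mem hy hz
      | smul r z _ hz => rw [smul_mul_assoc]; exact Submodule.smul_mem _ _ hz
    obtain ⟨a, p, r, hr, hrv⟩ := exists_ghostPath_mul_eq_smul (I := J) (y := vertex R v) hb
      (by rwa [mul_assoc, vertex_mul_self])
    refine ⟨a, v, v, v, p, .nil, r, vertex R v, .vertex v fun h => hrv ?_, hrv, ?_⟩
    · exact smul_mem_ideal _ _ (hHJ v h)
    · rw [path, mul_assoc, hr, sub_self]
      exact zero_mem _
  | succ n ih =>
    -- Either some edge carries `z` outside `J` and shortens the ghost parts, or `z` annihilates all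
    -- edges modulo `J` and, at a vertex `v`, agrees with a combination of paths times a gap.
    by_cases he : ∃ (a b : E) (e : a ⟶ b), z * edge R e ∉ J
    · obtain ⟨a, b, e, he⟩ := he
      obtain ⟨a', b', c, d, p, q, r, y, hy, hry, h⟩ := ih (mul_edge_mem_span e hz) he
      by_cases hbc : b = c
      · subst hbc
        refine ⟨a', b', a, d, p, e.toPath.comp q, r, y, hy, hry, ?_⟩
        simpa only [path_comp, path_toPath, mul_assoc] using h
      · refine ⟨a', b', c, d, p, q, r, y, hy, hry, ?_⟩
        rw [mul_assoc, mul_assoc, ← edge_mul_vertex, mul_assoc (edge R e),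
          vertex_mul_path_of_ne hbc] at h
        exact absurd (by simpa using h) hry
    · push Not at he
      obtain ⟨v, hv⟩ := exists_mul_vertex_notMem hzI
      obtain ⟨b, hb, T, hT⟩ := exists_mul_gap_eq hz v
      have hzb : z * vertex R v - b * gap R v T ∈ J := by
        rw [← hT T subset_rfl, ← mul_sub, gap, sub_sub_cancel, Finset.mul_sum]
        refine sum_mem fun e _ => ?_
        rw [← mul_assoc]
        exact J.mul_mem_right _ _ (he _ _ _)
      have hbT : b * gap R v T ∉ J := fun h => hv (by simpa using add_mem hzb h)
      obtain ⟨a, p, r, hr, hrT⟩ := exists_ghostPath_mul_eq_smul hb hbT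
      have hr0 : r ≠ 0 := by
        rintro rfl
        exact hrT (by rw [zero_smul]; exact zero_mem _)
      -- For `e ∉ T` the gap fixes `e`, so `b * e` equals `z * e` and lies in `J`; compressing it by
      -- `p` and `e` yields `r` times the range of `e`.
      have hout : ∀ e : Quiver.Star v, e ∉ T → e.1 ∈ H := by
        intro e heT
        refine hH r _ hr0 ?_
        have h₁ : b * edge R e.2 ∈ J := by
          have := hT T subset_rfl
          have h₂ := congrArg (· * edge R e.2) this
          simp only [mul_assoc, gap_mul_edge, if_neg heT] at h₂
          rw [← h₂]
          exact he _ _ _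
        have h₂ : r • vertex R e.1 = ghost R e.2 * (ghostPath R p * (b * edge R e.2)) := by
          rw [← mul_assoc (ghostPath R p), hr, smul_mul_assoc, mul_smul_comm, vertex_mul_edge,
            ghost_mul_edge_self]
        rw [h₂]
        exact J.mul_mem_left _ _ (J.mul_mem_left _ _ h₁)
      have hvH : v ∉ H := fun h => hrT <| smul_mem_ideal _ _ <| by
        rw [← vertex_mul_gap]
        exact J.mul_mem_right _ _ (hHJ v h)
      set F := T.filter fun e => e.1 ∉ H with hF
      have hFH : {e : Quiver.Star v | e.1 ∉ H} = F := by
        ext e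
        simp only [Set.mem_ofPred_eq, hF, Finset.coe_filter]
        exact ⟨fun h => ⟨by_contra fun h' => h (hout e h'), h⟩, fun h => h.2⟩
      have hFT : gap R v F - gap R v T ∈ J := by
        refine gap_sub_gap_mem (Finset.filter_subset _ _) fun e h h' => hHJ _ ?_
        by_contra h''
        exact h' (Finset.mem_filter.2 ⟨h, h''⟩)
      have hrF : r • gap R v F ∉ J := fun h => hrT <| by
        have := sub_mem h (smul_mem_ideal _ r hFT)
        rwa [smul_sub, sub_sub_cancel] at this
      have hFJ : gap R v F ∉ J := fun h => hrF (smul_mem_ideal _ _ h)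
      have key : ghostPath R p * z * path R (.nil : Quiver.Path v v) - r • gap R v F ∈ J := by
        have h₁ := J.mul_mem_left (ghostPath R p) _ hzb
        rw [mul_sub, ← mul_assoc _ b, hr, smul_mul_assoc, vertex_mul_gap] at h₁
        have h₂ := smul_mem_ideal _ r hFT
        rw [smul_sub] at h₂
        rw [path, mul_assoc]
        convert sub_mem h₁ h₂ using 1
        abel
      refine ⟨a, v, v, v, p, .nil, r, gap R v F, ?_, hrF, key⟩
      rcases F.eq_empty_or_nonempty with hF0 | hFne
      · rw [hF0, gap_empty]
        exact .vertex v hvH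
      -- At a finite emitter the full gap is zero by the defining relation, so `gap R v F` would lie
      -- in `J`.
      · have hinf : Infinite (Quiver.Star v) := by
          by_contra hfin
          rw [not_infinite_iff_finite] at hfin
          have := Fintype.ofFinite (Quiver.Star v)
          have : Nonempty (Quiver.Star v) := hFne.to_type
          have h : gap R v F - gap R v Finset.univ ∈ J :=
            gap_sub_gap_mem (Finset.subset_univ F) fun e _ h' => hHJ _ <| by
              by_contra h''
              exact h' (Finset.mem_coe.1 (hFH ▸ h''))
          rw [gap_univ, sub_zero] at h
          exact hFJ h
        have hvB : v ∈ graphB H :=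
          ⟨hvH, hinf, by rw [hFH]; exact hFne, by rw [hFH]; exact F.finite_toSet⟩
        rw [← vertexGap_eq_gap hFH] at hFJ ⊢
        exact .gap v hvB fun hS => hFJ (TwoSidedIdeal.subset_span (.inr ⟨v, hS, rfl⟩))

end Reduction

/-! ### Universal property -/

section Lift

variable {R : Type x} [CommRing R] {E : Type u} [Quiver.{w} E]
  {A : Type*} [NonUnitalRing A] [Module R A] [IsScalarTower R A A] [SMulCommClass R A A]

variable (R) in
/-- The homomorphism from the free algebra determined by the images of the generators. -/
def freeLift (f : LeavittGen E → A) : LeavittFree R E →ₙₐ[R] A :=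
  MonoidAlgebra.liftMagma R (FreeSemigroup.lift f)

@[simp] theorem freeLift_of (f : LeavittGen E → A) (g : LeavittGen E) :
    freeLift R f (LeavittFree.of R g) = f g := by
  simp [freeLift, LeavittFree.of]

/-- The universal property of the Leavitt path algebra. -/
def lift (f : LeavittGen E → A)
    (hf : ∀ a b, LeavittRel R E a b → freeLift R f a = freeLift R f b) :
    LeavittPathAlgebra R E →ₙₐ[R] A where
  toFun := Quotient.lift (freeLift R f) fun a b h => by
    change RingConGen.Rel _ a b at h
    induction h with
    | of a b h => exact hf a b h
    | refl a => rfl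
    | symm _ ih => exact ih.symm
    | trans _ _ ih₁ ih₂ => exact ih₁.trans ih₂
    | add _ _ ih₁ ih₂ => rw [map_add, map_add, ih₁, ih₂]
    | mul _ _ ih₁ ih₂ => rw [map_mul, map_mul, ih₁, ih₂]
  map_smul' r a := by
    obtain ⟨a, rfl⟩ := mk_surjective a
    exact map_smul (freeLift R f) r a
  map_zero' := map_zero (freeLift R f)
  map_add' a b := by
    obtain ⟨a, rfl⟩ := mk_surjective a
    obtain ⟨b, rfl⟩ := mk_surjective b
    exact map_add (freeLift R f) a b
  map_mul' a b := by
    obtain ⟨a, rfl⟩ := mk_surjective a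
    obtain ⟨b, rfl⟩ := mk_surjective b
    exact map_mul (freeLift R f) a b

theorem lift_mk_of (f : LeavittGen E → A)
    (hf : ∀ a b, LeavittRel R E a b → freeLift R f a = freeLift R f b) (g : LeavittGen E) :
    lift f hf (mk R E (LeavittFree.of R g)) = f g :=
  freeLift_of f g

end Lift

/-! ### Operators on functions induced by partial bijections -/

section PartialBijections

variable {X : Type*}

open Classical in
/-- The partial bijection given by a function that is injective on a set. -/
def pequivOfInjOn (D : Set X) (F : X → X) (hF : Set.InjOn F D) : X ≃. X where
  toFun x := if x ∈ D then some (F x) else none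
  invFun y := if h : ∃ x ∈ D, F x = y then some h.choose else none
  inv x y := by
    constructor
    · intro h
      split_ifs at h with h'
      · obtain rfl : h'.choose = x := by simpa using h
        simp [h'.choose_spec.1, h'.choose_spec.2]
    · intro h
      split_ifs at h with h'
      · obtain rfl : F x = y := by simpa using h
        have hex : ∃ z ∈ D, F z = F x := ⟨x, h', rfl⟩
        rw [dif_pos hex]
        exact congrArg some (hF hex.choose_spec.1 h' hex.choose_spec.2)

theorem mem_pequivOfInjOn {D : Set X} {F : X → X} {hF : Set.InjOn F D} {x y : X} :
    y ∈ pequivOfInjOn D F hF x ↔ x ∈ D ∧ F x = y := by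
  classical
  change y ∈ (if x ∈ D then some (F x) else none) ↔ _
  split_ifs with h <;> simp [h]

variable (R : Type*) [CommRing R]

/-- The operator on functions induced by a partial bijection. -/
def partialOp (g : X ≃. X) : Module.End R (X → R) where
  toFun f x := (g x).elim 0 f
  map_add' f f' := by
    funext x
    simp only [Pi.add_apply]
    cases g x <;> simp
  map_smul' r f := by
    funext x
    simp only [Pi.smul_apply, RingHom.id_apply]
    cases g x <;> simp

variable {R}

theorem partialOp_apply_of_mem {g : X ≃. X} {x y : X} (h : y ∈ g x) (f : X → R) :
    partialOp R g f x = f y := by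
  change (g x).elim 0 f = _
  rw [Option.mem_def.1 h, Option.elim_some]

theorem partialOp_apply_eq_zero {g : X ≃. X} {f : X → R} {x : X} (h : ∀ y ∈ g x, f y = 0) :
    partialOp R g f x = 0 := by
  change (g x).elim 0 f = _
  cases hx : g x with
  | none => rfl
  | some y => exact h y hx

/-- The operators act by precomposition, so products correspond to composition in diagrammatic
order. -/
theorem partialOp_mul (g h : X ≃. X) :
    partialOp R g * partialOp R h = partialOp R (g.trans h) := by
  ext f x
  change (g x).elim 0 (fun y => (h y).elim 0 f) = ((g x).bind h).elim 0 f
  cases g x <;> rfl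

@[simp] theorem partialOp_bot : partialOp R (⊥ : X ≃. X) = 0 := by
  ext f x
  exact partialOp_apply_eq_zero fun y hy => absurd hy (by simp)

theorem pequiv_ext_mem {g h : X ≃. X} (H : ∀ x y, y ∈ g x ↔ y ∈ h x) : g = h :=
  PEquiv.ext fun x => Option.ext fun y => H x y

theorem pequiv_eq_bot {g : X ≃. X} (H : ∀ x y, y ∉ g x) : g = ⊥ :=
  pequiv_ext_mem fun x y => iff_of_false (H x y) (by simp)

end PartialBijections

/-! ### Codings of edges by natural numbers -/

section Coding

variable {E : Type u} [Quiver.{w} E]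

/-- Injections of `ℕ` into `ℕ` for the edges with a given source and with range outside `H`, whose
images are disjoint; they cover `ℕ` except at the vertices of `B_H ∖ S`, where they omit `0`. -/
structure EdgeCoding (H S : Set E) where
  code : ∀ v : E, Quiver.Star v → ℕ → ℕ
  injective : ∀ (v : E) (e e' : Quiver.Star v) (n n' : ℕ), e.1 ∉ H → e'.1 ∉ H →
    code v e n = code v e' n' → e = e' ∧ n = n'
  surjective : ∀ v : E, (v ∈ graphB H → v ∈ S) → (∃ e : Quiver.Star v, e.1 ∉ H) →
    ∀ n, ∃ (e : Quiver.Star v) (m : ℕ), e.1 ∉ H ∧ code v e m = n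
  ne_zero : ∀ v ∈ graphB H, v ∉ S → ∀ (e : Quiver.Star v) (m : ℕ), e.1 ∉ H → code v e m ≠ 0

/-- The product of the set of edges from `v` with range outside `H` and `ℕ` is countably infinite if
that set is nonempty, hence in bijection with `ℕ`. At vertices of `B_H ∖ S` the bijection is shifted
by one to free the code `0`. -/
theorem nonempty_edgeCoding [Countable E] [∀ a b : E, Countable (a ⟶ b)] (H S : Set E) :
    Nonempty (EdgeCoding H S) := by
  classical
  have key : ∀ v : E, ∃ c : Quiver.Star v → ℕ → ℕ,
      (∀ (e e' : Quiver.Star v) (n n' : ℕ), e.1 ∉ H → e'.1 ∉ H →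
        c e n = c e' n' → e = e' ∧ n = n') ∧
      ((v ∈ graphB H → v ∈ S) → (∃ e : Quiver.Star v, e.1 ∉ H) →
        ∀ n, ∃ (e : Quiver.Star v) (m : ℕ), e.1 ∉ H ∧ c e m = n) ∧
      (v ∈ graphB H → v ∉ S → ∀ (e : Quiver.Star v) (m : ℕ), e.1 ∉ H → c e m ≠ 0) := by
    intro v
    by_cases hT : ∃ e : Quiver.Star v, e.1 ∉ H
    · have : Nonempty {e : Quiver.Star v // e.1 ∉ H} := let ⟨e, he⟩ := hT; ⟨⟨e, he⟩⟩
      obtain ⟨g⟩ := nonempty_equiv_of_countable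
        (α := {e : Quiver.Star v // e.1 ∉ H} × ℕ) (β := ℕ)
      let shift : ℕ := if v ∈ graphB H → v ∈ S then 0 else 1
      refine ⟨fun e n => if he : e.1 ∉ H then g (⟨e, he⟩, n) + shift else 0, ?_, ?_, ?_⟩
      · intro e e' n n' he he' h
        simp only [dif_pos he, dif_pos he', add_left_inj, EmbeddingLike.apply_eq_iff_eq,
          Prod.mk.injEq, Subtype.mk.injEq] at h
        exact h
      · intro hv _ n
        obtain ⟨⟨⟨e, he⟩, m⟩, rfl⟩ := g.surjective n
        exact ⟨e, m, he, by simp only [dif_pos he, shift, if_pos hv, add_zero]⟩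
      · intro hv hS e m he
        have : ¬ (v ∈ graphB H → v ∈ S) := fun h => hS (h hv)
        simp only [dif_pos he, shift, if_neg this]
        omega
    · push Not at hT
      exact ⟨fun _ _ => 0, fun e _ _ _ he => absurd (hT e) he, fun _ ⟨e, he⟩ => absurd (hT e) he,
        fun _ _ e _ he => absurd (hT e) he⟩
  choose c h₁ h₂ h₃ using key
  exact ⟨⟨c, h₁, h₂, h₃⟩⟩

/-- Hereditary saturated sets of vertices. -/
structure IsHereditarySaturated (H : Set E) : Prop where
  hereditary : ∀ {a b : E}, (a ⟶ b) → a ∈ H → b ∈ H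
  saturated : ∀ v : E, Nonempty (Quiver.Star v) → Finite (Quiver.Star v) →
    (∀ e : Quiver.Star v, e.1 ∈ H) → v ∈ H

end Coding

section VertexDomain

variable {E : Type u}

/-- The set on which the partial bijections act: copies of `ℕ` for all vertices and degrees. -/
abbrev CodePoint (E : Type u) : Type u := E × ℕ × ℤ

open Classical in
/-- The partial identity at a vertex; it is empty for the vertices in `H`. -/
def vertexDomain (H : Set E) (v : E) : CodePoint E ≃. CodePoint E :=
  PEquiv.ofSet {y | y.1 = v ∧ v ∉ H}

theorem mem_vertexDomain {H : Set E} {v : E} {y z : CodePoint E} :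
    z ∈ vertexDomain H v y ↔ z = y ∧ z.1 = v ∧ v ∉ H := by
  classical
  exact PEquiv.mem_ofSet_iff

theorem vertexDomain_trans_self (H : Set E) (v : E) :
    (vertexDomain H v).trans (vertexDomain H v) = vertexDomain H v := by
  refine pequiv_ext_mem fun y z => ?_
  simp only [PEquiv.mem_trans, mem_vertexDomain]
  grind

end VertexDomain

/-! ### The representation attached to a coding -/

section Representation

variable (R : Type x) [CommRing R] {E : Type u} [Quiver.{w} E] {H S : Set E}

namespace EdgeCoding

variable (c : EdgeCoding H S)

/-- The partial bijection of an edge. -/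
def chart {v : E} (e : Quiver.Star v) : CodePoint E ≃. CodePoint E :=
  pequivOfInjOn {y | y.1 = e.1 ∧ e.1 ∉ H} (fun y => (v, c.code v e y.2.1, y.2.2 + 1)) <| by
    rintro ⟨a, n, k⟩ ⟨rfl, he⟩ ⟨b, m, l⟩ ⟨hb, -⟩ h
    simp only [Prod.mk.injEq, true_and, add_left_inj] at h
    obtain ⟨-, rfl⟩ := c.injective v e e n m he he h.1
    exact Prod.ext hb.symm (Prod.ext rfl h.2)

variable {c}

theorem mem_chart {v : E} {e : Quiver.Star v} {y z : CodePoint E} :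
    z ∈ c.chart e y ↔ (y.1 = e.1 ∧ e.1 ∉ H) ∧ (v, c.code v e y.2.1, y.2.2 + 1) = z :=
  mem_pequivOfInjOn

variable (c)

/-- The images of the generators under the representation. -/
def genOp : LeavittGen E → Module.End R (CodePoint E → R)
  | .vertex v => partialOp R (vertexDomain H v)
  | .edge e => partialOp R (c.chart (⟨e.right, e.hom⟩ : Quiver.Star e.left)).symm
  | .ghost e => partialOp R (c.chart (⟨e.right, e.hom⟩ : Quiver.Star e.left))

/-- Heredity is what places the image in the domain of the source: if the range of `e` is outside
`H`, so is `v`. -/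
theorem chart_trans_vertexDomain (hH : IsHereditarySaturated H) {v : E} (e : Quiver.Star v) :
    (c.chart e).trans (vertexDomain H v) = c.chart e := by
  have hv : e.1 ∉ H → v ∉ H := fun h h' => h (hH.hereditary e.2 h')
  refine pequiv_ext_mem fun y z => ?_
  simp only [PEquiv.mem_trans, mem_vertexDomain, mem_chart]
  constructor
  · rintro ⟨_, h, rfl, -⟩
    exact h
  · rintro ⟨⟨h₁, h₂⟩, rfl⟩
    exact ⟨_, ⟨⟨h₁, h₂⟩, rfl⟩, rfl, rfl, hv h₂⟩

theorem vertexDomain_trans_chart {v : E} (e : Quiver.Star v) :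
    (vertexDomain H e.1).trans (c.chart e) = c.chart e := by
  refine pequiv_ext_mem fun y z => ?_
  simp only [PEquiv.mem_trans, mem_vertexDomain, mem_chart]
  grind

theorem chart_trans_symm {v : E} (e : Quiver.Star v) :
    (c.chart e).trans (c.chart e).symm = vertexDomain H e.1 := by
  refine pequiv_ext_mem fun y z => ?_
  rw [PEquiv.self_trans_symm, PEquiv.mem_ofSet_iff, mem_vertexDomain]
  refine and_congr_right ?_
  rintro rfl
  change (c.chart e z).isSome ↔ _
  rw [Option.isSome_iff_exists]
  constructor
  · rintro ⟨y, hy⟩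
    exact (mem_chart.1 hy).1
  · intro h
    exact ⟨_, mem_chart.2 ⟨h, rfl⟩⟩

theorem chart_trans_symm_of_ne {v v' : E} (e : Quiver.Star v) (e' : Quiver.Star v')
    (h : (⟨v, e.1, e.2⟩ : Quiver.Total E) ≠ ⟨v', e'.1, e'.2⟩) :
    (c.chart e).trans (c.chart e').symm = ⊥ := by
  refine pequiv_eq_bot fun y z => ?_
  simp only [PEquiv.mem_trans, PEquiv.mem_iff_mem, mem_chart]
  rintro ⟨_, ⟨⟨-, he⟩, rfl⟩, ⟨-, he'⟩, h'⟩
  simp only [Prod.mk.injEq] at h'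
  obtain ⟨rfl, h', -⟩ := h'
  obtain ⟨rfl, -⟩ := c.injective _ _ _ _ _ he' he h'
  exact h rfl

theorem symm_trans_chart {v : E} (e : Quiver.Star v) {y z : CodePoint E} :
    z ∈ (c.chart e).symm.trans (c.chart e) y ↔
      y = z ∧ z.1 = v ∧ e.1 ∉ H ∧ ∃ m, c.code v e m = z.2.1 := by
  simp only [PEquiv.mem_trans, PEquiv.mem_iff_mem, mem_chart]
  constructor
  · rintro ⟨⟨a, n, k⟩, ⟨h, rfl⟩, -, rfl⟩
    exact ⟨rfl, rfl, h.2, n, rfl⟩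
  · rintro ⟨rfl, rfl, he, m, hm⟩
    exact ⟨(e.1, m, y.2.2 - 1), ⟨⟨rfl, he⟩, by simp [hm]⟩, ⟨rfl, he⟩, by simp [hm]⟩

/-- The value at a point of the operator of `∑ e e*`. -/
theorem sum_chart_apply_of_mem {v : E} (F : Finset (Quiver.Star v)) (f : CodePoint E → R)
    {y : CodePoint E} (hy : y.1 = v) {e : Quiver.Star v} (heF : e ∈ F) (he : e.1 ∉ H) {m : ℕ}
    (hm : c.code v e m = y.2.1) :
    (∑ e ∈ F, partialOp R (c.chart e).symm * partialOp R (c.chart e)) f y = f y := by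
  rw [LinearMap.sum_apply, Finset.sum_apply, Finset.sum_eq_single_of_mem e heF]
  · rw [partialOp_mul]
    exact partialOp_apply_of_mem (c.symm_trans_chart e |>.2 ⟨rfl, hy, he, m, hm⟩) f
  · intro e' _ hne
    rw [partialOp_mul]
    refine partialOp_apply_eq_zero fun z hz => ?_
    obtain ⟨rfl, -, he', m', hm'⟩ := (c.symm_trans_chart e').1 hz
    exact absurd (c.injective v _ _ _ _ he' he (hm'.trans hm.symm)).1 hne

theorem sum_chart_apply_of_notMem {v : E} (F : Finset (Quiver.Star v)) (f : CodePoint E → R)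
    {y : CodePoint E} (hy : y.1 = v → ∀ e ∈ F, ∀ m, e.1 ∉ H → c.code v e m ≠ y.2.1) :
    (∑ e ∈ F, partialOp R (c.chart e).symm * partialOp R (c.chart e)) f y = 0 := by
  rw [LinearMap.sum_apply, Finset.sum_apply]
  refine Finset.sum_eq_zero fun e he => ?_
  rw [partialOp_mul]
  refine partialOp_apply_eq_zero fun z hz => ?_
  obtain ⟨rfl, h, he', m, hm⟩ := (c.symm_trans_chart e).1 hz
  exact absurd hm (hy h e he m he')

/-- `v` acts as `∑ e e*` if the codes of the edges in the sum cover `ℕ`. -/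
theorem partialOp_vertexDomain_eq_sum (hH : IsHereditarySaturated H) {v : E}
    (F : Finset (Quiver.Star v))
    (hF : v ∉ H → ∀ n, ∃ e ∈ F, ∃ m, e.1 ∉ H ∧ c.code v e m = n) :
    partialOp R (vertexDomain H v) =
      ∑ e ∈ F, partialOp R (c.chart e).symm * partialOp R (c.chart e) := by
  refine LinearMap.ext fun f => funext fun y => ?_
  by_cases hy : y.1 = v ∧ v ∉ H
  · obtain ⟨e, heF, m, he, hm⟩ := hF hy.2 y.2.1
    rw [c.sum_chart_apply_of_mem R F f hy.1 heF he hm]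
    exact partialOp_apply_of_mem (mem_vertexDomain.2 ⟨rfl, hy⟩) f
  · rw [c.sum_chart_apply_of_notMem R]
    · refine partialOp_apply_eq_zero fun z hz => ?_
      obtain ⟨rfl, h⟩ := mem_vertexDomain.1 hz
      exact absurd h hy
    · intro hyv e _ m he
      exact absurd ⟨hyv, fun h => he (hH.hereditary e.2 h)⟩ hy

theorem freeLift_genOp_eq (hH : IsHereditarySaturated H)
    (a b : LeavittFree R E) (h : LeavittRel R E a b) :
    freeLift R (c.genOp R) a = freeLift R (c.genOp R) b := by
  induction h with
  | vertex_idem v =>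
    simp only [map_mul, freeLift_of, genOp, partialOp_mul, vertexDomain_trans_self]
  | vertex_orth v w h =>
    simp only [map_mul, freeLift_of, genOp, partialOp_mul, map_zero]
    rw [← partialOp_bot]
    congr 1
    refine pequiv_eq_bot fun y z => ?_
    simp only [PEquiv.mem_trans, mem_vertexDomain]
    grind
  | source_edge e =>
    simp only [map_mul, freeLift_of, genOp, partialOp_mul]
    congr 1
    conv_rhs => rw [← c.chart_trans_vertexDomain hH]
    rw [PEquiv.symm_trans_rev]
    simp [vertexDomain]
  | edge_range e =>
    simp only [map_mul, freeLift_of, genOp, partialOp_mul]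
    congr 1
    conv_rhs => rw [← c.vertexDomain_trans_chart]
    rw [PEquiv.symm_trans_rev]
    simp [vertexDomain]
  | range_ghost e =>
    simp only [map_mul, freeLift_of, genOp, partialOp_mul]
    rw [c.vertexDomain_trans_chart ⟨e.right, e.hom⟩]
  | ghost_source e =>
    simp only [map_mul, freeLift_of, genOp, partialOp_mul, c.chart_trans_vertexDomain hH]
  | ghost_edge_self e =>
    simp only [map_mul, freeLift_of, genOp, partialOp_mul, chart_trans_symm]
  | ghost_edge_ne e f h =>
    simp only [map_mul, freeLift_of, genOp, partialOp_mul, map_zero]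
    rw [c.chart_trans_symm_of_ne _ _ h, partialOp_bot]
  | finite_emitter v =>
    simp only [map_sum, map_mul, freeLift_of, genOp]
    refine c.partialOp_vertexDomain_eq_sum R hH Finset.univ fun hv n => ?_
    -- A finite emitter is never in `B_H`, so no code is omitted there; saturation provides an edge
    -- leaving `H` when `v ∉ H`.
    have hvB : v ∈ graphB H → v ∈ S := fun h =>
      absurd h.2.1 (not_infinite_iff_finite.2 inferInstance)
    have hex : ∃ e : Quiver.Star v, e.1 ∉ H := by
      by_contra! h
      exact hv (hH.saturated v inferInstance inferInstance h)
    obtain ⟨e, m, he, hm⟩ := c.surjective v hvB hex n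
    exact ⟨e, Finset.mem_univ e, m, he, hm⟩
  | smul r h ih => rw [map_smul, map_smul, ih]

/-- The representation of the Leavitt path algebra on functions on `E × ℕ × ℤ` given by a coding
of the edges. -/
def rep (hH : IsHereditarySaturated H) :
    LeavittPathAlgebra R E →ₙₐ[R] Module.End R (CodePoint E → R) :=
  lift (c.genOp R) (c.freeLift_genOp_eq R hH)

variable (hH : IsHereditarySaturated H)

theorem rep_vertex (v : E) :
    c.rep R hH (vertex R v) = partialOp R (vertexDomain H v) :=
  lift_mk_of _ _ (.vertex v)

theorem rep_edge {v : E} (e : Quiver.Star v) :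
    c.rep R hH (edge R e.2) = partialOp R (c.chart e).symm :=
  lift_mk_of _ _ (.edge ⟨v, e.1, e.2⟩)

theorem rep_ghost {v : E} (e : Quiver.Star v) :
    c.rep R hH (ghost R e.2) = partialOp R (c.chart e) :=
  lift_mk_of _ _ (.ghost ⟨v, e.1, e.2⟩)

theorem rep_gap (v : E) (F : Finset (Quiver.Star v)) :
    c.rep R hH (gap R v F) = partialOp R (vertexDomain H v) -
      ∑ e ∈ F, partialOp R (c.chart e).symm * partialOp R (c.chart e) := by
  simp only [gap, map_sub, map_sum, map_mul, rep_vertex, rep_edge, rep_ghost]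

theorem idealOfPair_le_ker (hS : S ⊆ graphB H) :
    idealOfPair R H S ≤ TwoSidedIdeal.ker (c.rep R hH) := by
  rw [idealOfPair, TwoSidedIdeal.span_le]
  rintro _ (⟨v, hv, rfl⟩ | ⟨v, hv, rfl⟩) <;> rw [SetLike.mem_coe, TwoSidedIdeal.mem_ker]
  · rw [rep_vertex]
    refine LinearMap.ext fun f => funext fun y => partialOp_apply_eq_zero fun z hz => ?_
    exact absurd hv (mem_vertexDomain.1 hz).2.2
  · obtain ⟨F, hF, h⟩ := exists_vertexGap_eq_gap (R := R) (hS hv)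
    rw [h, rep_gap, sub_eq_zero]
    refine c.partialOp_vertexDomain_eq_sum R hH F fun _ n => ?_
    obtain ⟨e, m, he, hm⟩ := c.surjective v (fun _ => hv) (hS hv).2.2.1 n
    exact ⟨e, by rw [← Finset.mem_coe, ← hF]; exact he, m, he, hm⟩

/-- The constant function `1` is tested at `(u, 0, 0)`. For `u ∈ B_H ∖ S` the code `0` is hit by no
edge, so the sum of the $ee^*$ contributes nothing there. -/
theorem smul_rep_ne_zero {z : LeavittPathAlgebra R E} (hz : IsCorner R H S z) {r : R}
    (hr : r ≠ 0) : r • c.rep R hH z ≠ 0 := by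
  have key : ∃ y, c.rep R hH z (fun _ => 1) y = 1 := by
    cases hz with
    | vertex u hu =>
      refine ⟨(u, 0, 0), ?_⟩
      rw [rep_vertex]
      exact partialOp_apply_of_mem (mem_vertexDomain.2 ⟨rfl, rfl, hu⟩) _
    | gap u hu huS =>
      obtain ⟨F, hF, h⟩ := exists_vertexGap_eq_gap (R := R) hu
      refine ⟨(u, 0, 0), ?_⟩
      rw [h, rep_gap, LinearMap.sub_apply, Pi.sub_apply, c.sum_chart_apply_of_notMem R, sub_zero]
      · exact partialOp_apply_of_mem (mem_vertexDomain.2 ⟨rfl, rfl, hu.1⟩) _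
      · exact fun _ e _ m he => c.ne_zero u hu huS e m he
  obtain ⟨y, hy⟩ := key
  intro h
  have h' := congrFun (LinearMap.congr_fun h fun _ => 1) y
  rw [LinearMap.smul_apply, Pi.smul_apply, hy] at h'
  exact hr (by simpa using h')

end EdgeCoding

end Representation

/-! ### Degrees of operators -/

section Degree

open scoped Pointwise

variable {R : Type x} [CommRing R] {E : Type u}

/-- An operator on functions on `E × ℕ × ℤ` has degrees in `s` if its values at points of degree
`k` depend only on the values of the function at points of degree `k - d` with `d ∈ s`. -/
def HasDegreesIn (s : Set ℤ) (T : Module.End R (CodePoint E → R)) : Prop :=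
  ∀ (f : CodePoint E → R) (y : CodePoint E),
    (∀ z : CodePoint E, y.2.2 - z.2.2 ∈ s → f z = 0) → T f y = 0

namespace HasDegreesIn

variable {s t : Set ℤ} {T U : Module.End R (CodePoint E → R)}

theorem zero : HasDegreesIn s (0 : Module.End R (CodePoint E → R)) := fun _ _ _ => rfl

theorem mono (h : s ⊆ t) (hT : HasDegreesIn s T) : HasDegreesIn t T :=
  fun f y hf => hT f y fun z hz => hf z (h hz)

theorem add (hT : HasDegreesIn s T) (hU : HasDegreesIn s U) : HasDegreesIn s (T + U) :=
  fun f y hf => by rw [LinearMap.add_apply, Pi.add_apply, hT f y hf, hU f y hf, add_zero]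

theorem smul (r : R) (hT : HasDegreesIn s T) : HasDegreesIn s (r • T) :=
  fun f y hf => by rw [LinearMap.smul_apply, Pi.smul_apply, hT f y hf, smul_zero]

theorem sum {ι : Type*} {F : Finset ι} {T : ι → Module.End R (CodePoint E → R)}
    (hT : ∀ i ∈ F, HasDegreesIn s (T i)) : HasDegreesIn s (∑ i ∈ F, T i) :=
  Finset.sum_induction T (HasDegreesIn s) (fun _ _ => add) zero hT

theorem mul (hT : HasDegreesIn s T) (hU : HasDegreesIn t U) : HasDegreesIn (s + t) (T * U) :=
  fun f y hf => hT (U f) y fun z hz => hU f z fun z' hz' => hf z' <| by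
    rw [← sub_add_sub_cancel]
    exact Set.add_mem_add hz hz'

/-- Operators with degrees in disjoint sets are independent. -/
theorem eq_zero_of_add_eq_zero (hT : HasDegreesIn s T) (hU : HasDegreesIn t U)
    (hst : Disjoint s t) (h : T + U = 0) : T = 0 := by
  classical
  refine LinearMap.ext fun f => funext fun y => ?_
  -- With `y` fixed, `f'` keeps only the values that `T` can see at `y`; disjointness makes them
  -- invisible to `U`.
  let f' : CodePoint E → R := fun z => if y.2.2 - z.2.2 ∈ s then f z else 0
  have h₁ : T (f - f') y = 0 := hT _ y fun z hz => by simp [f', if_pos hz]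
  have h₂ : U f' y = 0 := hU _ y fun z hz => if_neg fun h => Set.disjoint_left.1 hst h hz
  have h₃ : T f' y + U f' y = 0 := congrFun (LinearMap.congr_fun h f') y
  rw [map_sub, Pi.sub_apply, sub_eq_zero] at h₁
  rw [h₁, LinearMap.zero_apply, Pi.zero_apply]
  rwa [h₂, add_zero] at h₃

end HasDegreesIn

variable [Quiver.{w} E] {H S : Set E} (c : EdgeCoding H S) (hH : IsHereditarySaturated H)

namespace EdgeCoding

theorem hasDegreesIn_vertex (v : E) : HasDegreesIn {0} (c.rep R hH (vertex R v)) := by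
  intro f y hf
  rw [rep_vertex]
  refine partialOp_apply_eq_zero fun z hz => hf z ?_
  rw [(mem_vertexDomain.1 hz).1]
  simp

theorem hasDegreesIn_path {a b : E} (p : Quiver.Path a b) :
    HasDegreesIn {(p.length : ℤ)} (c.rep R hH (path R p)) := by
  induction p with
  | nil => exact c.hasDegreesIn_vertex hH a
  | @cons b d p e ih =>
    rw [path, map_mul]
    have h : HasDegreesIn {1} (c.rep R hH (edge R e)) := by
      intro f y hf
      rw [c.rep_edge R hH (⟨d, e⟩ : Quiver.Star b)]
      refine partialOp_apply_eq_zero fun z hz => hf z ?_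
      rw [PEquiv.mem_iff_mem, mem_chart] at hz
      obtain ⟨-, rfl⟩ := hz
      simp
    refine (ih.mul h).mono ?_
    simp

theorem hasDegreesIn_ghostPath {a b : E} (p : Quiver.Path a b) :
    HasDegreesIn {-(p.length : ℤ)} (c.rep R hH (ghostPath R p)) := by
  induction p with
  | nil => exact c.hasDegreesIn_vertex hH a
  | @cons b d p e ih =>
    rw [ghostPath, map_mul]
    have h : HasDegreesIn {-1} (c.rep R hH (ghost R e)) := by
      intro f y hf
      rw [c.rep_ghost R hH (⟨d, e⟩ : Quiver.Star b)]
      refine partialOp_apply_eq_zero fun z hz => hf z ?_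
      rw [mem_chart] at hz
      obtain ⟨-, rfl⟩ := hz
      simp
    refine (h.mul ih).mono ?_
    simp

theorem hasDegreesIn_of_mem_component {k : ℤ} {z : LeavittPathAlgebra R E}
    (hz : z ∈ component R E k) : HasDegreesIn {k} (c.rep R hH z) := by
  induction hz using Submodule.span_induction with
  | mem z hz =>
    obtain ⟨a, b, d, α, β, hk, rfl⟩ := hz
    rw [map_mul]
    refine ((c.hasDegreesIn_path hH α).mul (c.hasDegreesIn_ghostPath hH β)).mono ?_
    rw [Set.singleton_add_singleton, ← sub_eq_add_neg, hk]
  | zero => rw [map_zero]; exact .zero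
  | add y z _ _ hy hz => rw [map_add]; exact hy.add hz
  | smul r z _ hz => rw [map_smul]; exact hz.smul r

/-- The homogeneous components of elements of the kernel lie in the kernel. -/
theorem rep_component_eq_zero {f : ℤ →₀ LeavittPathAlgebra R E}
    (hf : ∀ k, f k ∈ component R E k) (h : c.rep R hH (f.sum fun _ y => y) = 0) (k : ℤ) :
    c.rep R hH (f k) = 0 := by
  classical
  by_cases hk : k ∈ f.support
  · rw [Finsupp.sum, ← Finset.add_sum_erase _ _ hk, map_add, map_sum] at h
    refine (c.hasDegreesIn_of_mem_component hH (hf k)).eq_zero_of_add_eq_zero (t := {k}ᶜ) ?_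
      disjoint_compl_right h
    refine HasDegreesIn.sum fun i hi => (c.hasDegreesIn_of_mem_component hH (hf i)).mono ?_
    simpa using (Finset.ne_of_mem_erase hi).symm
  · rw [Finsupp.notMem_support_iff.1 hk, map_zero]

end EdgeCoding

end Degree

/-! ### The kernel is $I(H,S)$; gradedness, basicness and a primeness criterion -/

section KernelIdeal

open scoped Pointwise

variable {R : Type x} [CommRing R] {E : Type u} [Quiver.{w} E] {H S : Set E}

namespace EdgeCoding

theorem mem_of_smul_vertex_mem (c : EdgeCoding H S) (hH : IsHereditarySaturated H) (hS : S ⊆ graphB H) (r : R) (v : E)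
    (hr : r ≠ 0) (h : r • vertex R v ∈ idealOfPair R H S) : v ∈ H := by
  by_contra hv
  refine c.smul_rep_ne_zero R hH (.vertex v hv) hr ?_
  rw [← map_smul]
  exact c.idealOfPair_le_ker R hH hS h

variable (c : EdgeCoding H S) (hH : IsHereditarySaturated H)

/-- The kernel of the representation is `I(H, S)`. -/
theorem ker_eq_idealOfPair (hS : S ⊆ graphB H) :
    TwoSidedIdeal.ker (c.rep R hH) = idealOfPair R H S := by
  refine le_antisymm (fun z hz => ?_) (c.idealOfPair_le_ker R hH hS)
  obtain ⟨f, hf, rfl⟩ := exists_finsupp_component z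
  refine sum_mem fun k _ => ?_
  by_contra hk
  obtain ⟨n, hn⟩ := exists_mem_span_monomials (hf k)
  obtain ⟨a, b, a', b', p, q, r, y, hy, hry, h⟩ :=
    exists_reduction (c.mem_of_smul_vertex_mem hH hS) hn hk
  have hr : r ≠ 0 := by
    rintro rfl
    exact hry (by rw [zero_smul]; exact zero_mem _)
  -- The component `f k` acts as zero, so its compression `r • y` does too, which is impossible for
  -- a corner.
  refine c.smul_rep_ne_zero R hH hy hr ?_
  have h₁ := (TwoSidedIdeal.mem_ker _).1 (c.idealOfPair_le_ker R hH hS h)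
  rw [map_sub, map_mul, map_mul, c.rep_component_eq_zero hH hf ((TwoSidedIdeal.mem_ker _).1 hz) k,
    mul_zero, zero_mul, zero_sub, neg_eq_zero, map_smul] at h₁
  exact h₁

/-- `J` contains an element that is, modulo the kernel of the representation, the sum of a nonzero
multiple of `y` and of terms of smaller degree. -/
def HasLeadingPart (J : TwoSidedIdeal (LeavittPathAlgebra R E)) (y : LeavittPathAlgebra R E) :
    Prop :=
  ∃ r : R, r ≠ 0 ∧ ∃ d : ℤ, ∃ z ∈ J, ∃ T, c.rep R hH z = r • c.rep R hH y + T ∧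
    HasDegreesIn {d} (r • c.rep R hH y) ∧ HasDegreesIn (Set.Iio d) T

theorem singleton_add_Iio (a b : ℤ) : ({a} : Set ℤ) + Set.Iio b ⊆ Set.Iio (a + b) := by
  rintro _ ⟨a', rfl, b', hb, rfl⟩
  have := Set.mem_Iio.1 hb
  exact Set.mem_Iio.2 (show a' + b' < _ by omega)

theorem Iio_add_singleton (a b : ℤ) : Set.Iio a + ({b} : Set ℤ) ⊆ Set.Iio (a + b) := by
  rintro _ ⟨a', ha, b', rfl, rfl⟩
  have := Set.mem_Iio.1 ha
  exact Set.mem_Iio.2 (show a' + b' < _ by omega)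

theorem Iio_add_Iio (a b : ℤ) : Set.Iio a + Set.Iio b ⊆ Set.Iio (a + b) := by
  rintro _ ⟨a', ha, b', hb, rfl⟩
  exact Set.mem_Iio.2 (add_lt_add (Set.mem_Iio.1 ha) (Set.mem_Iio.1 hb))

variable {c hH}

/-- Homogeneous factors shift all degrees equally. The new leading part may vanish; it is nonzero
once `l * y * t` is a corner. -/
theorem HasLeadingPart.mul_mul {J : TwoSidedIdeal (LeavittPathAlgebra R E)}
    {y l t : LeavittPathAlgebra R E} (h : c.HasLeadingPart hH J y) {i j : ℤ}
    (hl : l ∈ component R E i) (ht : t ∈ component R E j) :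
    c.HasLeadingPart hH J (l * y * t) := by
  obtain ⟨r, hr, d, z, hz, T, hzT, hd, hT⟩ := h
  have hl := c.hasDegreesIn_of_mem_component hH hl
  have ht := c.hasDegreesIn_of_mem_component hH ht
  refine ⟨r, hr, i + d + j, l * z * t, J.mul_mem_right _ _ (J.mul_mem_left _ _ hz),
    c.rep R hH l * T * c.rep R hH t, ?_, ?_, ?_⟩
  · rw [map_mul, map_mul, hzT, mul_add, add_mul, mul_smul_comm, smul_mul_assoc, map_mul, map_mul]
  · rw [map_mul, map_mul, ← smul_mul_assoc, ← mul_smul_comm]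
    refine ((hl.mul hd).mul ht).mono ?_
    simp
  · exact ((((hl.mul hT).mono (singleton_add_Iio i d)).mul ht).mono (Iio_add_singleton _ _))

variable (c hH)

/-- The component of largest degree outside $I(H,S)$ is compressed to a corner; components of higher
degree lie in the ideal and act as zero. -/
theorem exists_hasLeadingPart (hS : S ⊆ graphB H) {J : TwoSidedIdeal (LeavittPathAlgebra R E)}
    (hJ : ¬ J ≤ idealOfPair R H S) : ∃ y, IsCorner R H S y ∧ c.HasLeadingPart hH J y := by
  classical
  obtain ⟨z, hzJ, hzI⟩ := SetLike.not_le_iff_exists.1 hJ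
  obtain ⟨f, hf, rfl⟩ := exists_finsupp_component z
  have hne : (f.support.filter fun k => f k ∉ idealOfPair R H S).Nonempty := by
    by_contra h
    rw [Finset.not_nonempty_iff_eq_empty, Finset.filter_eq_empty_iff] at h
    exact hzI (sum_mem fun k hk => not_not.1 (h hk))
  obtain ⟨m, hm, hmax⟩ := Finset.exists_max_image _ id hne
  rw [Finset.mem_filter] at hm
  obtain ⟨n, hn⟩ := exists_mem_span_monomials (hf m)
  obtain ⟨a, b, a', b', p, q, r, y, hy, hry, h⟩ :=
    exists_reduction (c.mem_of_smul_vertex_mem hH hS) hn hm.2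
  have hr : r ≠ 0 := by
    rintro rfl
    exact hry (by rw [zero_smul]; exact zero_mem _)
  have hp := c.hasDegreesIn_ghostPath (R := R) hH p
  have hq := c.hasDegreesIn_path (R := R) hH q
  have h₁ := (TwoSidedIdeal.mem_ker _).1 (c.idealOfPair_le_ker R hH hS h)
  rw [map_sub, map_mul, map_mul, map_smul, sub_eq_zero] at h₁
  refine ⟨y, hy, r, hr, -p.length + m + q.length, ghostPath R p * (f.sum fun _ y => y) * path R q,
    J.mul_mem_right _ _ (J.mul_mem_left _ _ hzJ),
    c.rep R hH (ghostPath R p) * (∑ k ∈ f.support.erase m, c.rep R hH (f k)) *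
      c.rep R hH (path R q), ?_, ?_, ?_⟩
  · rw [← h₁, map_mul, map_mul, Finsupp.sum, map_sum, ← Finset.add_sum_erase _ _ hm.1, mul_add,
      add_mul]
  · rw [← h₁]
    refine ((hp.mul (c.hasDegreesIn_of_mem_component hH (hf m))).mul hq).mono ?_
    simp
  · refine (((hp.mul ?_).mono (singleton_add_Iio _ m)).mul hq).mono (Iio_add_singleton _ _)
    refine HasDegreesIn.sum fun k hk => ?_
    by_cases hkm : k < m
    · exact (c.hasDegreesIn_of_mem_component hH (hf k)).mono (by simpa using hkm)
    · have hkI : f k ∈ idealOfPair R H S := by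
        by_contra hkI
        have := hmax k (Finset.mem_filter.2 ⟨Finset.mem_of_mem_erase hk, hkI⟩)
        have := Finset.ne_of_mem_erase hk
        simp only [id] at *
        omega
      rw [(TwoSidedIdeal.mem_ker _).1 (c.idealOfPair_le_ker R hH hS hkI)]
      exact .zero

variable {c hH}

/-- The top-degree part of the product is `(r * s) • y` by idempotence, and `r * s ≠ 0` in a domain.
-/
theorem HasLeadingPart.exists_mul_notMem [IsDomain R] (hS : S ⊆ graphB H)
    {J K : TwoSidedIdeal (LeavittPathAlgebra R E)} {y : LeavittPathAlgebra R E}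
    (hy : IsCorner R H S y) (hyy : y * y = y) (hJ : c.HasLeadingPart hH J y)
    (hK : c.HasLeadingPart hH K y) : ∃ a ∈ J, ∃ b ∈ K, a * b ∉ idealOfPair R H S := by
  obtain ⟨r, hr, d, a, ha, T, haT, hd, hT⟩ := hJ
  obtain ⟨s, hs, e, b, hb, U, hbU, he, hU⟩ := hK
  refine ⟨a, ha, b, hb, fun h => ?_⟩
  have h := (TwoSidedIdeal.mem_ker _).1 (c.idealOfPair_le_ker R hH hS h)
  rw [map_mul, haT, hbU, add_mul, mul_add, mul_add, add_assoc] at h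
  have h₁ : r • c.rep R hH y * s • c.rep R hH y = 0 :=
    (hd.mul he).eq_zero_of_add_eq_zero (t := Set.Iio (d + e))
      (((hd.mul hU).mono (singleton_add_Iio d e)).add
        (((hT.mul he).mono (Iio_add_singleton d e)).add ((hT.mul hU).mono (Iio_add_Iio d e))))
      (by simp) h
  rw [smul_mul_smul_comm, ← map_mul, hyy] at h₁
  exact c.smul_rep_ne_zero R hH hy (mul_ne_zero hr hs) h₁

end EdgeCoding

theorem IsCorner.mul_self {y : LeavittPathAlgebra R E}
    (hy : IsCorner R H S y) : y * y = y := by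
  cases hy with
  | vertex u hu => exact vertex_mul_self u
  | gap u hu _ =>
    obtain ⟨F, -, h⟩ := exists_vertexGap_eq_gap (R := R) hu
    rw [h, gap_mul_self]

variable [Countable E] [∀ a b : E, Countable (a ⟶ b)]

variable (R) in
theorem isGradedIdeal_idealOfPair (hH : IsHereditarySaturated H) (hS : S ⊆ graphB H) :
    IsGradedIdeal (idealOfPair R H S) := by
  obtain ⟨c⟩ := nonempty_edgeCoding H S
  intro z hz
  obtain ⟨f, hf, rfl⟩ := exists_finsupp_component z
  refine ⟨f, fun k => ⟨hf k, ?_⟩, rfl⟩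
  rw [← c.ker_eq_idealOfPair hH hS, TwoSidedIdeal.mem_ker] at hz ⊢
  exact c.rep_component_eq_zero hH hf hz k

/-- The quotient embeds into operators on `R`-valued functions, which have no `R`-torsion. -/
theorem mem_idealOfPair_of_smul_mem [IsDomain R] (hH : IsHereditarySaturated H)
    (hS : S ⊆ graphB H) {r : R} (hr : r ≠ 0) {z : LeavittPathAlgebra R E}
    (h : r • z ∈ idealOfPair R H S) : z ∈ idealOfPair R H S := by
  obtain ⟨c⟩ := nonempty_edgeCoding H S
  rw [← c.ker_eq_idealOfPair hH hS, TwoSidedIdeal.mem_ker] at h ⊢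
  rw [map_smul] at h
  refine LinearMap.ext fun f => funext fun y => ?_
  have h' := congrFun (LinearMap.congr_fun h f) y
  exact (smul_eq_zero.1 h').resolve_left hr

variable (R) in
theorem isBasicIdeal_idealOfPair [IsDomain R] (hH : IsHereditarySaturated H)
    (hS : S ⊆ graphB H) : IsBasicIdeal (idealOfPair R H S) :=
  ⟨fun _ hr _ => mem_idealOfPair_of_smul_mem hH hS hr,
    fun _ hr _ _ => mem_idealOfPair_of_smul_mem hH hS hr⟩

/-- `I(H, S)` is prime if any two corners can be brought to a common corner. -/
theorem isPrimeIdeal_idealOfPair [IsDomain R] (hH : IsHereditarySaturated H) (hS : S ⊆ graphB H)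
    (hne : H ≠ Set.univ)
    (hdir : ∀ y y', IsCorner R H S y → IsCorner R H S y' → ∃ z, IsCorner R H S z ∧
      (∃ i, ∃ l ∈ component R E i, ∃ j, ∃ t ∈ component R E j, l * y * t = z) ∧
      (∃ i, ∃ l ∈ component R E i, ∃ j, ∃ t ∈ component R E j, l * y' * t = z)) :
    IsPrimeIdeal (idealOfPair R H S) := by
  obtain ⟨c⟩ := nonempty_edgeCoding H S
  refine ⟨fun h => ?_, fun J K hJK => ?_⟩
  · obtain ⟨v, hv⟩ := (Set.ne_univ_iff_exists_notMem H).1 hne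
    refine hv (c.mem_of_smul_vertex_mem (R := R) hH hS 1 v one_ne_zero ?_)
    rw [h]
    trivial
  · by_contra! hJK'
    obtain ⟨y, hy, hJ⟩ := c.exists_hasLeadingPart hH hS hJK'.1
    obtain ⟨y', hy', hK⟩ := c.exists_hasLeadingPart hH hS hJK'.2
    obtain ⟨z, hz, ⟨i, l, hl, j, t, ht, rfl⟩, i', l', hl', j', t', ht', h⟩ := hdir y y' hy hy'
    have hK := hK.mul_mul hl' ht'
    rw [h] at hK
    obtain ⟨a, ha, b, hb, hab⟩ :=
      (hJ.mul_mul hl ht).exists_mul_notMem hS hz (hz.mul_self) hK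
    exact hab (hJK a ha b hb)

end KernelIdeal

/-! ### Hereditary saturated sets from maximal tails and breaking vertices -/

section Graph

variable {E : Type u} [Quiver.{w} E]

theorem graphOmega_singleton (v : E) : graphOmega {v} = {w | ¬ GraphGE w v} := by
  ext w
  constructor
  · exact fun h => h.2 v rfl
  · refine fun h => ⟨?_, ?_⟩
    · rintro rfl
      exact h ⟨.nil⟩
    · rintro _ rfl
      exact h

theorem _root_.IsMaximalTail.graphOmega_eq {M : Set E} (hM : IsMaximalTail M) : graphOmega M = Mᶜ := by
  ext w
  exact ⟨fun h => h.1, fun h => ⟨h, fun v hv hwv => h (hM.mt1 w v hv hwv)⟩⟩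

theorem _root_.IsMaximalTail.isHereditarySaturated {M : Set E} (hM : IsMaximalTail M) :
    IsHereditarySaturated Mᶜ where
  hereditary e ha hb := ha (hM.mt1 _ _ hb ⟨e.toPath⟩)
  saturated v hne hfin h hv := by
    obtain ⟨e, he⟩ := hM.mt2 v hv hne hfin
    exact h e he

theorem _root_.IsBreakingVertex.isHereditarySaturated {v : E} (hv : IsBreakingVertex v) :
    IsHereditarySaturated (graphOmega {v}) := by
  rw [graphOmega_singleton]
  refine ⟨fun e ha ⟨p⟩ => ha ⟨e.toPath.comp p⟩, fun u _ hfin h ⟨p⟩ => ?_⟩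
  by_cases hp : p.length = 0
  · obtain rfl := Quiver.Path.eq_of_length_zero p hp
    exact not_infinite_iff_finite.2 hfin hv.1
  · obtain ⟨c, e, q, -, -⟩ := (Quiver.Path.length_ne_zero_iff_eq_comp p).1 hp
    exact h ⟨c, e⟩ ⟨q⟩

end Graph

/-! ### Primeness of the two families, and the converse -/

section Primes

variable {R : Type x} [CommRing R] {E : Type u} [Quiver.{w} E]

theorem path_mem_component {a b : E} (p : Quiver.Path a b) :
    path R p ∈ component R E p.length :=
  Submodule.subset_span ⟨a, b, b, p, .nil, by simp, (path_mul_vertex p).symm⟩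

theorem ghostPath_mem_component {a b : E} (p : Quiver.Path a b) :
    ghostPath R p ∈ component R E (-p.length) :=
  Submodule.subset_span ⟨b, a, b, .nil, p, by simp, (vertex_mul_ghostPath p).symm⟩

theorem path_mul_gap_mem_component {a v : E} (p : Quiver.Path a v) (F : Finset (Quiver.Star v)) :
    path R p * gap R v F ∈ component R E p.length := by
  rw [gap, mul_sub, path_mul_vertex, Finset.mul_sum]
  refine sub_mem (path_mem_component p) (sum_mem fun e _ => ?_)
  exact Submodule.subset_span ⟨a, v, e.1, p.cons e.2, e.2.toPath, by simp,
    by rw [path, ghostPath_toPath, mul_assoc]⟩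

theorem ghostPath_mul_vertex_mul_path {a b : E} (p : Quiver.Path a b) :
    ghostPath R p * vertex R a * path R p = vertex R b := by
  rw [ghostPath_mul_vertex, ghostPath_mul_path_self]

section

variable (R) [IsDomain R] [Countable E] [∀ a b : E, Countable (a ⟶ b)]

/-- With `S = B_H` all corners are vertices, and (MT3) supplies a common vertex below two of them.
-/
theorem isPrimeIdeal_of_isMaximalTail {M : Set E} (hM : IsMaximalTail M) :
    IsPrimeIdeal (idealOfPair R Mᶜ (graphB Mᶜ)) := by
  refine isPrimeIdeal_idealOfPair hM.isHereditarySaturated subset_rfl ?_ ?_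
  · rw [Ne, Set.compl_univ_iff]
    exact hM.nonempty.ne_empty
  · intro y y' hy hy'
    cases hy with
    | gap _ h h' => exact absurd h h'
    | vertex v hv =>
    cases hy' with
    | gap _ h h' => exact absurd h h'
    | vertex v' hv' =>
    obtain ⟨u, hu, ⟨p⟩, ⟨p'⟩⟩ := hM.mt3 v (not_not.1 hv) v' (not_not.1 hv')
    exact ⟨vertex R u, .vertex u (not_not.2 hu),
      ⟨_, _, ghostPath_mem_component p, _, _, path_mem_component p,
        ghostPath_mul_vertex_mul_path p⟩,
      ⟨_, _, ghostPath_mem_component p', _, _, path_mem_component p',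
        ghostPath_mul_vertex_mul_path p'⟩⟩

/-- Every corner compresses to $v^H$: vertices outside `H` reach `v`, and the only gap among the
corners is that of `v`. -/
theorem isPrimeIdeal_of_isBreakingVertex {v : E} (hv : IsBreakingVertex v) :
    IsPrimeIdeal (idealOfPair R (graphOmega {v}) (graphB (graphOmega {v}) \ {v})) := by
  refine isPrimeIdeal_idealOfPair hv.isHereditarySaturated Set.sdiff_subset ?_ ?_
  · exact (Set.ne_univ_iff_exists_notMem _).2 ⟨v, hv.2.1⟩
  · obtain ⟨F, -, hF⟩ := exists_vertexGap_eq_gap (R := R) hv.2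
    have key : ∀ y, IsCorner R (graphOmega {v}) (graphB (graphOmega {v}) \ {v}) y →
        ∃ i, ∃ l ∈ component R E i, ∃ j, ∃ t ∈ component R E j,
          l * y * t = vertexGap R (graphOmega {v}) v := by
      intro y hy
      cases hy with
      | vertex u hu =>
        rw [graphOmega_singleton] at hu
        obtain ⟨p⟩ := not_not.1 hu
        refine ⟨_, _, ghostPath_mem_component p, _, _, path_mul_gap_mem_component p F, ?_⟩
        rw [hF, ← mul_assoc, ghostPath_mul_vertex_mul_path, vertex_mul_gap]
      | gap u hu hu' =>
        obtain rfl : u = v := by_contra fun h => hu' ⟨hu, h⟩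
        have h := path_mem_component (R := R) (.nil : Quiver.Path u u)
        refine ⟨_, _, h, _, _, h, ?_⟩
        rw [hF, path, vertex_mul_gap, gap_mul_vertex]
    intro y y' hy hy'
    exact ⟨_, .gap v hv.2 fun h => h.2 rfl, key y hy, key y' hy'⟩

end

/-- If `I` is prime and `a L b ⊆ I`, where `b` has a left unit, then `a ∈ I` or `b ∈ I`. -/
theorem IsPrimeIdeal.exists_mul_mul_notMem {I : TwoSidedIdeal (LeavittPathAlgebra R E)}
    (hI : IsPrimeIdeal I) {a b e : LeavittPathAlgebra R E} (he : e * b = b) (ha : a ∉ I)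
    (hb : b ∉ I) :
    ∃ (s t r : E) (α : Quiver.Path s r) (β : Quiver.Path t r),
      a * (path R α * ghostPath R β) * b ∉ I := by
  by_contra! hmon
  have h : ∀ z, a * z * b ∈ I := fun z => by
    induction z using monomial_induction with
    | mem s t r α β => exact hmon s t r α β
    | zero => simp
    | add y z hy hz =>
      rw [mul_add, add_mul]
      exact add_mem hy hz
    | smul r z hz =>
      rw [mul_smul_comm, smul_mul_assoc]
      exact smul_mem_ideal I r hz
  -- `J` consists of the `z` with $zLb\subseteq I$, and `K` is its right annihilator modulo `I`.
  -- Then $JK\subseteq I$, while `a ∈ J` and, thanks to the left unit `e`, `b ∈ K`.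
  let J : TwoSidedIdeal (LeavittPathAlgebra R E) :=
    .mk' {z | ∀ l, z * l * b ∈ I} (by simp)
      (fun hx hy l => by
        rw [add_mul, add_mul]
        exact add_mem (hx l) (hy l))
      (fun hx l => by
        rw [neg_mul, neg_mul]
        exact neg_mem (hx l))
      (fun hy l => by
        rw [mul_assoc, mul_assoc, ← mul_assoc _ l]
        exact I.mul_mem_left _ _ (hy l))
      (fun hx l => by
        rw [mul_assoc _ _ l]
        exact hx _)
  have hJ : ∀ z, z ∈ J ↔ ∀ l, z * l * b ∈ I := fun z => TwoSidedIdeal.mem_mk' ..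
  let K : TwoSidedIdeal (LeavittPathAlgebra R E) :=
    .mk' {z | ∀ l ∈ J, l * z ∈ I} (by simp)
      (fun hx hy l hl => by
        rw [mul_add]
        exact add_mem (hx l hl) (hy l hl))
      (fun hx l hl => by
        rw [mul_neg]
        exact neg_mem (hx l hl))
      (fun hy l hl => by
        rw [← mul_assoc]
        exact hy _ (J.mul_mem_right _ _ hl))
      (fun hx l hl => by
        rw [← mul_assoc]
        exact I.mul_mem_right _ _ (hx l hl))
  have hK : ∀ z, z ∈ K ↔ ∀ l ∈ J, l * z ∈ I := fun z => TwoSidedIdeal.mem_mk' ..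
  rcases hI.2 J K fun y hy z hz => (hK z).1 hz y hy with hJI | hKI
  · exact ha (hJI ((hJ a).2 h))
  · refine hb (hKI ((hK b).2 fun l hl => ?_))
    rw [← he, ← mul_assoc]
    exact (hJ l).1 hl e

/-- The first edge of `p` either occurs in the sum and is killed by the gap, or has its range in
`H`. -/
theorem vertexGap_mul_path_mem {I : TwoSidedIdeal (LeavittPathAlgebra R E)} {H : Set E}
    (hH : ∀ v ∈ H, vertex R v ∈ I) {v b : E} (hv : v ∈ graphB H) (p : Quiver.Path v b)
    (hp : p.length ≠ 0) : vertexGap R H v * path R p ∈ I := by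
  obtain ⟨F, hF, h⟩ := exists_vertexGap_eq_gap (R := R) hv
  obtain ⟨c, e, q, rfl, -⟩ := (Quiver.Path.length_ne_zero_iff_eq_comp p).1 hp
  classical
  rw [h, path_comp, path_toPath, ← mul_assoc, gap_mul_edge (⟨c, e⟩ : Quiver.Star v)]
  split_ifs with he
  · simp
  · refine I.mul_mem_right _ _ ?_
    rw [← edge_mul_vertex]
    refine I.mul_mem_left _ _ (hH c ?_)
    by_contra hc
    exact he (by rw [← Finset.mem_coe, ← hF]; exact hc)

theorem ghostPath_mul_vertexGap_mem {I : TwoSidedIdeal (LeavittPathAlgebra R E)} {H : Set E}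
    (hH : ∀ v ∈ H, vertex R v ∈ I) {v b : E} (hv : v ∈ graphB H) (p : Quiver.Path v b)
    (hp : p.length ≠ 0) : ghostPath R p * vertexGap R H v ∈ I := by
  obtain ⟨F, hF, h⟩ := exists_vertexGap_eq_gap (R := R) hv
  obtain ⟨c, e, q, rfl, -⟩ := (Quiver.Path.length_ne_zero_iff_eq_comp p).1 hp
  classical
  rw [h, ghostPath_comp, ghostPath_toPath, mul_assoc, ghost_mul_gap (⟨c, e⟩ : Quiver.Star v)]
  split_ifs with he
  · simp
  · refine I.mul_mem_left _ _ ?_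
    rw [← vertex_mul_ghost]
    refine I.mul_mem_right _ _ (hH c ?_)
    by_contra hc
    exact he (by rw [← Finset.mem_coe, ← hF]; exact hc)

/-- The vertices that lie in an ideal. -/
def vertexSet (I : TwoSidedIdeal (LeavittPathAlgebra R E)) : Set E := {v | vertex R v ∈ I}

/-- The vertices `v` of `B_H` for which `v^H` lies in the ideal, where `H` is the set of vertices
in the ideal. -/
def gapSet (I : TwoSidedIdeal (LeavittPathAlgebra R E)) : Set E :=
  {v | v ∈ graphB (vertexSet I) ∧ vertexGap R (vertexSet I) v ∈ I}

theorem idealOfPair_vertexSet_le (I : TwoSidedIdeal (LeavittPathAlgebra R E)) :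
    idealOfPair R (vertexSet I) (gapSet I) ≤ I := by
  rw [idealOfPair, TwoSidedIdeal.span_le]
  rintro _ (⟨v, hv, rfl⟩ | ⟨v, hv, rfl⟩)
  · exact hv
  · exact hv.2

/-- A graded basic ideal is generated by the vertices and the elements `v^H` that it contains. -/
theorem eq_idealOfPair_vertexSet {I : TwoSidedIdeal (LeavittPathAlgebra R E)}
    (hg : IsGradedIdeal I) (hb : IsBasicIdeal I) :
    I = idealOfPair R (vertexSet I) (gapSet I) := by
  have hle := idealOfPair_vertexSet_le I
  refine le_antisymm (fun z hz => ?_) hle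
  obtain ⟨f, hf, rfl⟩ := hg z hz
  refine sum_mem fun k _ => ?_
  by_contra hk
  obtain ⟨n, hn⟩ := exists_mem_span_monomials (hf k).1
  -- Basicness, rather than the representation, supplies the hypothesis on vertices, so `H` need not
  -- be known to be hereditary or saturated.
  obtain ⟨a, b, a', b', p, q, r, y, hy, hry, h⟩ :=
    exists_reduction (fun r v hr h => hb.1 r hr v (hle h)) hn hk
  have hr : r ≠ 0 := by
    rintro rfl
    exact hry (by rw [zero_smul]; exact zero_mem _)
  have hryI : r • y ∈ I := by
    have := sub_mem (I.mul_mem_right _ (path R q) (I.mul_mem_left (ghostPath R p) _ (hf k).2))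
      (hle h)
    rwa [sub_sub_cancel] at this
  cases hy with
  | vertex u hu => exact hu (hb.1 r hr u hryI)
  | gap u hu hu' =>
    change u ∈ graphB (vertexSet I) at hu
    change r • vertexGap R (vertexSet I) u ∈ I at hryI
    obtain ⟨F, -, hF⟩ := exists_vertexGap_eq_gap (R := R) hu
    refine hu' ⟨hu, ?_⟩
    rw [hF] at hryI ⊢
    exact hb.2 r hr u F hryI

theorem mem_vertexSet_of_path {I : TwoSidedIdeal (LeavittPathAlgebra R E)} {v w : E}
    (p : Quiver.Path v w) (hv : v ∈ vertexSet I) : w ∈ vertexSet I := by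
  change vertex R w ∈ I
  rw [← ghostPath_mul_vertex_mul_path p]
  exact I.mul_mem_right _ _ (I.mul_mem_left _ _ hv)

/-- For (MT3), primeness gives a monomial with $v\,\alpha\beta^*w\notin I$; the common range of
$\alpha$ and $\beta$ is the required vertex. -/
theorem IsPrimeIdeal.isMaximalTail {I : TwoSidedIdeal (LeavittPathAlgebra R E)}
    (hI : IsPrimeIdeal I) : IsMaximalTail (vertexSet I)ᶜ where
  nonempty := by
    by_contra h
    rw [Set.not_nonempty_iff_eq_empty, Set.compl_empty_iff] at h
    refine hI.1 (top_unique fun z _ => ?_)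
    by_contra hz
    obtain ⟨v, hv⟩ := exists_mul_vertex_notMem hz
    have hvI : v ∈ vertexSet I := h ▸ Set.mem_univ v
    exact hv (I.mul_mem_left _ _ hvI)
  mt1 v w hw := fun ⟨p⟩ hv => hw (mem_vertexSet_of_path p hv)
  mt2 v hv hne hfin := by
    by_contra! h
    have := Fintype.ofFinite (Quiver.Star v)
    refine hv ?_
    change vertex R v ∈ I
    rw [vertex_eq_sum]
    refine sum_mem fun e _ => I.mul_mem_right _ _ ?_
    have he : vertex R e.1 ∈ I := not_not.1 (h e)
    rw [← edge_mul_vertex]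
    exact I.mul_mem_left _ _ he
  mt3 v hv w hw := by
    obtain ⟨s, t, r, α, β, h⟩ := hI.exists_mul_mul_notMem (vertex_mul_self w) hv hw
    have hs : v = s := by
      by_contra hs
      rw [← mul_assoc, vertex_mul_path_of_ne hs] at h
      simp at h
    have ht : t = w := by
      by_contra ht
      rw [mul_assoc, mul_assoc, ghostPath_mul_vertex_of_ne ht] at h
      simp at h
    subst hs ht
    refine ⟨r, fun hr => h ?_, ⟨α⟩, ⟨β⟩⟩
    rw [← path_mul_vertex α]
    exact I.mul_mem_right _ _ (I.mul_mem_left _ _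
      (I.mul_mem_right _ _ (I.mul_mem_left _ _ hr)))

/-- If `v^H` lies outside a prime ideal, then `a ≥ v` (with `a α ∉ I` for a path `α` from `a` to
`v`) for all elements `a` outside the ideal. -/
theorem IsPrimeIdeal.exists_mul_path_notMem {I : TwoSidedIdeal (LeavittPathAlgebra R E)}
    (hI : IsPrimeIdeal I) {v : E} (hv : v ∈ graphB (vertexSet I))
    (hvI : vertexGap R (vertexSet I) v ∉ I) {a : LeavittPathAlgebra R E} (ha : a ∉ I) :
    ∃ (s : E) (α : Quiver.Path s v), a * path R α ∉ I := by
  have hvv : vertex R v * vertexGap R (vertexSet I) v = vertexGap R (vertexSet I) v := by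
    obtain ⟨F, -, hF⟩ := exists_vertexGap_eq_gap (R := R) hv
    rw [hF, vertex_mul_gap]
  obtain ⟨s, t, r, α, β, h⟩ := hI.exists_mul_mul_notMem hvv ha hvI
  by_cases ht : t = v
  · subst ht
    -- A nontrivial $\beta^*$ sends $v^H$ into `I`, so $\beta$ must be trivial.
    by_cases hβ : β.length = 0
    · cases β with
      | cons => simp at hβ
      | nil =>
        refine ⟨s, α, fun h' => h ?_⟩
        rw [← mul_assoc, mul_assoc _ _ (vertexGap R _ _)]
        exact I.mul_mem_right _ _ h'
    · refine absurd ?_ h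
      rw [mul_assoc, mul_assoc]
      exact I.mul_mem_left _ _ (I.mul_mem_left _ _
        (ghostPath_mul_vertexGap_mem (fun _ => id) hv β hβ))
  · rw [← hvv, ← mul_assoc, mul_assoc a, mul_assoc (path R α), ghostPath_mul_vertex_of_ne ht] at h
    simp at h

theorem IsPrimeIdeal.vertexSet_eq_graphOmega {I : TwoSidedIdeal (LeavittPathAlgebra R E)}
    (hI : IsPrimeIdeal I) {v : E} (hv : v ∈ graphB (vertexSet I))
    (hvI : vertexGap R (vertexSet I) v ∉ I) : vertexSet I = graphOmega {v} := by
  rw [graphOmega_singleton]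
  ext u
  refine ⟨fun hu ⟨p⟩ => hv.1 (mem_vertexSet_of_path p hu), fun hu => ?_⟩
  by_contra hu'
  obtain ⟨s, α, h⟩ := hI.exists_mul_path_notMem hv hvI (a := vertex R u) hu'
  by_cases hs : u = s
  · subst hs
    exact hu ⟨α⟩
  · rw [vertex_mul_path_of_ne hs] at h
    exact h (zero_mem _)

theorem IsPrimeIdeal.gapSet_eq_diff {I : TwoSidedIdeal (LeavittPathAlgebra R E)}
    (hI : IsPrimeIdeal I) {v : E} (hv : v ∈ graphB (vertexSet I))
    (hvI : vertexGap R (vertexSet I) v ∉ I) : gapSet I = graphB (vertexSet I) \ {v} := by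
  ext u
  constructor
  · rintro ⟨hu, huI⟩
    refine ⟨hu, ?_⟩
    rintro rfl
    exact hvI huI
  · rintro ⟨hu, huv⟩
    refine ⟨hu, ?_⟩
    by_contra huI
    -- Modulo `I`, $u^H$ annihilates nontrivial paths from `u`, so `α` has length zero and `u = v`.
    obtain ⟨s, α, h⟩ := hI.exists_mul_path_notMem hv hvI huI
    by_cases hs : u = s
    · subst hs
      by_cases hα : α.length = 0
      · exact huv (Quiver.Path.eq_of_length_zero α hα)
      · exact h (vertexGap_mul_path_mem (fun _ => id) hu α hα)
    · obtain ⟨F, -, hF⟩ := exists_vertexGap_eq_gap (R := R) hu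
      rw [hF, ← gap_mul_vertex, mul_assoc, vertex_mul_path_of_ne hs, mul_zero] at h
      exact h (zero_mem _)

end Primes
end LeavittPathAlgebra
end

theorem theorem4p8 (R : Type x) [CommRing R] [IsDomain R]
    (E : Type u) [Quiver.{w} E] [Countable E] [∀ a b : E, Countable (a ⟶ b)] :
    {I : TwoSidedIdeal (LeavittPathAlgebra R E) |
        LeavittPathAlgebra.IsPrimeIdeal I ∧ LeavittPathAlgebra.IsGradedIdeal I ∧
          LeavittPathAlgebra.IsBasicIdeal I} =
      {I | ∃ M : Set E, IsMaximalTail M ∧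
          I = LeavittPathAlgebra.idealOfPair R (graphOmega M) (graphB (graphOmega M))} ∪
      {I | ∃ v : E, IsBreakingVertex v ∧
          I = LeavittPathAlgebra.idealOfPair R (graphOmega {v})
            (graphB (graphOmega {v}) \ {v})} := by
  open LeavittPathAlgebra in
  ext I
  constructor
  · rintro ⟨hp, hg, hb⟩
    have hI := eq_idealOfPair_vertexSet hg hb
    by_cases h : ∀ v ∈ graphB (vertexSet I), vertexGap R (vertexSet I) v ∈ I
    · refine .inl ⟨(vertexSet I)ᶜ, hp.isMaximalTail, ?_⟩
      have hS : gapSet I = graphB (vertexSet I) :=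
        Set.ext fun v => ⟨And.left, fun hv => ⟨hv, h v hv⟩⟩
      rw [hp.isMaximalTail.graphOmega_eq, compl_compl, ← hS]
      exact hI
    · push Not at h
      obtain ⟨v, hv, hvI⟩ := h
      have hH := hp.vertexSet_eq_graphOmega hv hvI
      refine .inr ⟨v, ⟨hv.2.1, hH ▸ hv⟩, ?_⟩
      rw [← hH, ← hp.gapSet_eq_diff hv hvI]
      exact hI
  · rintro (⟨M, hM, rfl⟩ | ⟨v, hv, rfl⟩)
    · rw [hM.graphOmega_eq]
      exact ⟨isPrimeIdeal_of_isMaximalTail R hM,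
        isGradedIdeal_idealOfPair R hM.isHereditarySaturated subset_rfl,
        isBasicIdeal_idealOfPair R hM.isHereditarySaturated subset_rfl⟩
    · exact ⟨isPrimeIdeal_of_isBreakingVertex R hv,
        isGradedIdeal_idealOfPair R hv.isHereditarySaturated Set.sdiff_subset,
        isBasicIdeal_idealOfPair R hv.isHereditarySaturated Set.sdiff_subset⟩
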